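/- Let $d\in\mathbb N_0$ and let $Q,P\in\mathbb C^{d\times d}$ be a Lagrangian frame, i.e. $Q^TP-P^TQ=0$ and $Q^*P-P^*Q=2i\,\mathrm{Id}_d$ (so $Q$ and $P$ are invertible). Put $$T=\begin{pmatrix}\mathrm{Re}\,Q&\mathrm{Im}\,Q\\ \mathrm{Re}\,P&\mathrm{Im}\,P\end{pmatrix}\in\mathbb R^{2d\times 2d}.$$ Fix either square root of $\det Q$ and let $\phi_0[Q,P](t)=2^{d/4}\det(Q)^{-1/2}e^{\pi i\, t^TPQ^{-1}t}$, $t\in\mathbb R^d$. With the operators $$A_j^\dagger f(t)=\sqrt{\pi}\,i\sum_{l=1}^d\Big(\overline{p_{lj}}\,t_lf(t)+\frac{i}{2\pi}\overline{q_{lj}}\,\frac{\partial f}{\partial t_l}(t)\Big),\qquad 1\le j\le d,$$ the Hagedorn wavepackets are $\phi_k[Q,P]=\frac1{\sqrt{k!}}(A_1^\dagger)^{k_1}\cdots(A_d^\dagger)^{k_d}\phi_0[Q,P]$, $k\in\mathbb N_0^d$. For $f,g\in L^2(\mathbb R^d)$ let $V_gf(x,\omega)=\int_{\mathbb R^d}f(t)\overline{g(t-x)}e^{-2\pi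 i\langle\omega,t\rangle}\,dt$. Let $\phi_k(t)=\prod_{j=1}^d\phi_{k_j}(t_j)$ be the product Hermite functions, where on $\mathbb R$ $$\phi_m(t)=\frac{2^{1/4}}{\sqrt{m!}}\Big(\frac{-1}{2\sqrt\pi}\Big)^me^{\pi t^2}\frac{d^m}{dt^m}e^{-2\pi t^2}.$$ With $L_k^\alpha(t)=\sum_{j=0}^k(-1)^j\binom{k+\alpha}{k-j}\frac{t^j}{j!}$, let, for $n,k\in\mathbb N_0$ and $z\in\mathbb C$, $$H_{n,k}(z)=\begin{cases}\sqrt{\frac{k!}{n!}}\,\pi^{\frac{n-k}2}z^{n-k}L_k^{n-k}(\pi|z|^2),&k<n,\\(-1)^{k-n}\sqrt{\frac{n!}{k!}}\,\pi^{\frac{k-n}2}\,\overline z^{\,k-n}L_n^{k-n}(\pi|z|^2),&n\le k.\end{cases}$$ Then $T$ is symplectic and every $\phi_k[Q,P]$ is in $L^2(\mathbb R^d)$. Moreover, for all $k,n\in\mathbb N_0^d$ and $x,\omega\in\mathbb R^d$, if $\zeta\in\mathbb C^d$ denotes $T^{-1}\binom{x}{\omega}\in\mathbb R^{2d}$ under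 the identification $(x',\omega')\mapsto x'+i\omega'$ of $\mathbb R^{2d}$ with $\mathbb C^d$, then $\zeta=-iP^Tx+iQ^T\omega$, $$V_{\phi_k[Q,P]}\phi_n[Q,P](x,\omega)=e^{-\pi i\langle x,\omega\rangle}e^{-\frac{\pi}{2}|\zeta|^2}\prod_{j=1}^d\overline{H_{n_j,k_j}(\zeta_j)},$$ and consequently $$\big|V_{\phi_k[Q,P]}\phi_n[Q,P](x,\omega)\big|=\Big|V_{\phi_k}\phi_n\Big(T^{-1}\binom{x}{\omega}\Big)\Big|.$$ -/

import Mathlib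

open MeasureTheory Matrix
open scoped ComplexConjugate

noncomputable section

/-! ### The short-time Fourier transform -/

/-- The short-time Fourier transform
`V_g f (x, ω) = ∫ f(t) conj(g(t - x)) e^{-2πi⟨ω, t⟩} dt` of `f` with window `g`. -/
def stft {d : ℕ} (g f : EuclideanSpace ℝ (Fin d) → ℂ) (x ω : EuclideanSpace ℝ (Fin d)) : ℂ :=
  ∫ t : EuclideanSpace ℝ (Fin d),
    f t * conj (g (t - x)) *
      Complex.exp (-2 * (Real.pi : ℂ) * Complex.I * ((inner ℝ ω t : ℝ) : ℂ))

/-! ### Hermite functions -/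

/-- The `n`-th Hermite function on the line,
`φ_n(t) = 2^{1/4} / √(n!) * (-1 / (2√π))^n * e^{πt²} * (d/dt)^n e^{-2πt²}`. -/
def hermiteFn (n : ℕ) (t : ℝ) : ℝ :=
  (2 : ℝ) ^ ((1 : ℝ) / 4) / √(n.factorial : ℝ) * (-1 / (2 * √Real.pi)) ^ n *
    Real.exp (Real.pi * t ^ 2) *
    iteratedDeriv n (fun s : ℝ => Real.exp (-2 * Real.pi * s ^ 2)) t

/-- The product Hermite function `φ_k(t) = ∏_j φ_{k_j}(t_j)` on `ℝ^d`. -/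
def productHermite {d : ℕ} (k : Fin d → ℕ) (t : EuclideanSpace ℝ (Fin d)) : ℂ :=
  ((∏ j, hermiteFn (k j) (t j) : ℝ) : ℂ)

/-! ### Laguerre polynomials and complex Hermite polynomials -/

/-- The generalized Laguerre polynomial `L_k^α(t) = ∑_{j=0}^k (-1)^j C(k+α, k-j) t^j / j!`
(with integer parameter `α ≥ 0`). -/
def laguerreFn (k α : ℕ) (t : ℝ) : ℝ :=
  ∑ j ∈ Finset.range (k + 1),
    (-1) ^ j * ((k + α).choose (k - j) : ℝ) * t ^ j / (j.factorial : ℝ)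

/-- The complex Hermite polynomial `H_{n,k}`: it is
`√(k!/n!) π^{(n-k)/2} z^{n-k} L_k^{n-k}(π|z|²)` if `k < n`, and
`(-1)^{k-n} √(n!/k!) π^{(k-n)/2} conj(z)^{k-n} L_n^{k-n}(π|z|²)` if `n ≤ k`. -/
def complexHermite (n k : ℕ) (z : ℂ) : ℂ :=
  if k < n then
    ((√((k.factorial : ℝ) / (n.factorial : ℝ)) * √Real.pi ^ (n - k) : ℝ) : ℂ) *
      z ^ (n - k) * ((laguerreFn k (n - k) (Real.pi * ‖z‖ ^ 2) : ℝ) : ℂ)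
  else
    (((-1) ^ (k - n) * √((n.factorial : ℝ) / (k.factorial : ℝ)) * √Real.pi ^ (k - n) : ℝ) : ℂ) *
      conj z ^ (k - n) * ((laguerreFn n (k - n) (Real.pi * ‖z‖ ^ 2) : ℝ) : ℂ)

/-! ### Lagrangian frames -/

/-- `(Q, P)` is a (normalized) Lagrangian frame:
`QᵀP - PᵀQ = 0` and `Q*P - P*Q = 2i Id`. Invertibility of `Q` and `P` follows,
see `IsLagrangianFrame.isUnit_left` and `IsLagrangianFrame.isUnit_right`. -/
structure IsLagrangianFrame {d : ℕ} (Q P : Matrix (Fin d) (Fin d) ℂ) : Prop where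
  symm : Qᵀ * P - Pᵀ * Q = 0
  normalized : Qᴴ * P - Pᴴ * Q = (2 * Complex.I) • (1 : Matrix (Fin d) (Fin d) ℂ)

section

open scoped ComplexOrder

theorem IsLagrangianFrame.isUnit_left {d : ℕ} {Q P : Matrix (Fin d) (Fin d) ℂ}
    (h : IsLagrangianFrame Q P) : IsUnit Q := by
  rw [← Matrix.mulVec_injective_iff_isUnit]
  refine (injective_iff_map_eq_zero (Matrix.mulVecLin Q)).2 fun v hv => ?_
  have hv : Q *ᵥ v = 0 := hv
  have h1 := congrArg (fun M => star v ⬝ᵥ (M *ᵥ v)) h.normalized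
  simp only [Matrix.sub_mulVec, ← Matrix.mulVec_mulVec, hv, Matrix.mulVec_zero, sub_zero,
    Matrix.smul_mulVec, Matrix.one_mulVec, dotProduct_smul] at h1
  rw [Matrix.dotProduct_mulVec, ← Matrix.star_mulVec, hv] at h1
  simpa [dotProduct_star_self_eq_zero] using h1

theorem IsLagrangianFrame.isUnit_right {d : ℕ} {Q P : Matrix (Fin d) (Fin d) ℂ}
    (h : IsLagrangianFrame Q P) : IsUnit P := by
  rw [← Matrix.mulVec_injective_iff_isUnit]
  refine (injective_iff_map_eq_zero (Matrix.mulVecLin P)).2 fun v hv => ?_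
  have hv : P *ᵥ v = 0 := hv
  have h1 := congrArg (fun M => star v ⬝ᵥ (M *ᵥ v)) h.normalized
  simp only [Matrix.sub_mulVec, ← Matrix.mulVec_mulVec, hv, Matrix.mulVec_zero, zero_sub,
    Matrix.smul_mulVec, Matrix.one_mulVec, dotProduct_smul, dotProduct_neg] at h1
  rw [Matrix.dotProduct_mulVec, ← Matrix.star_mulVec, hv] at h1
  simpa [dotProduct_star_self_eq_zero] using h1

end

/-- The real `2d × 2d` matrix `T = [[Re Q, Im Q], [Re P, Im P]]` of a frame. -/
def frameMatrix {d : ℕ} (Q P : Matrix (Fin d) (Fin d) ℂ) :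
    Matrix (Fin d ⊕ Fin d) (Fin d ⊕ Fin d) ℝ :=
  Matrix.fromBlocks (Q.map Complex.re) (Q.map Complex.im) (P.map Complex.re) (P.map Complex.im)

/-- Application of a real `2d × 2d` matrix to a phase space point `(x, ω)`. -/
def phaseMulVec {d : ℕ} (M : Matrix (Fin d ⊕ Fin d) (Fin d ⊕ Fin d) ℝ)
    (z : EuclideanSpace ℝ (Fin d) × EuclideanSpace ℝ (Fin d)) :
    EuclideanSpace ℝ (Fin d) × EuclideanSpace ℝ (Fin d) :=
  (WithLp.toLp 2 fun j => (M *ᵥ Sum.elim (fun i => z.1 i) (fun i => z.2 i)) (Sum.inl j),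
   WithLp.toLp 2 fun j => (M *ᵥ Sum.elim (fun i => z.1 i) (fun i => z.2 i)) (Sum.inr j))

/-- The identification `(x, ω) ↦ x + iω` of phase space `ℝ^{2d}` with `ℂ^d`. -/
def phaseToComplex {d : ℕ} (z : EuclideanSpace ℝ (Fin d) × EuclideanSpace ℝ (Fin d)) :
    EuclideanSpace ℂ (Fin d) :=
  WithLp.toLp 2 fun j => (z.1 j : ℂ) + Complex.I * (z.2 j : ℂ)

/-! ### Hagedorn wavepackets -/

/-- The Gaussian wavepacket
`φ_0[Q,P](t) = 2^{d/4} det(Q)^{-1/2} e^{πi t·PQ⁻¹t}`,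
where `s` is the chosen square root of `det Q`. -/
def hagedornGaussian {d : ℕ} (Q P : Matrix (Fin d) (Fin d) ℂ) (s : ℂ)
    (t : EuclideanSpace ℝ (Fin d)) : ℂ :=
  (((2 : ℝ) ^ ((d : ℝ) / 4) : ℝ) : ℂ) * s⁻¹ *
    Complex.exp ((Real.pi : ℂ) * Complex.I *
      ((fun i => (t i : ℂ)) ⬝ᵥ ((P * Q⁻¹) *ᵥ fun i => (t i : ℂ))))

/-- The `j`-th component of the raising operator `A†[Q,P]`:
`A†_j f(t) = √π i ∑_l (conj(p_{lj}) t_l f(t) + (i / 2π) conj(q_{lj}) ∂_l f(t))`. -/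
def hagedornRaise {d : ℕ} (Q P : Matrix (Fin d) (Fin d) ℂ) (j : Fin d)
    (f : EuclideanSpace ℝ (Fin d) → ℂ) (t : EuclideanSpace ℝ (Fin d)) : ℂ :=
  ((√Real.pi : ℝ) : ℂ) * Complex.I *
    ∑ l, (conj (P l j) * (t l : ℂ) * f t +
      Complex.I / (2 * (Real.pi : ℂ)) * conj (Q l j) *
        fderiv ℝ f t (EuclideanSpace.single l (1 : ℝ)))

/-- The `k`-th Hagedorn wavepacket
`φ_k[Q,P] = (k!)^{-1/2} (A†_1)^{k_1} (⋯ (A†_d)^{k_d} φ_0[Q,P])`. -/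
def hagedorn {d : ℕ} (Q P : Matrix (Fin d) (Fin d) ℂ) (s : ℂ) (k : Fin d → ℕ)
    (t : EuclideanSpace ℝ (Fin d)) : ℂ :=
  ((1 / √(∏ j, ((k j).factorial : ℝ)) : ℝ) : ℂ) *
    (List.finRange d).foldr (fun j f => (hagedornRaise Q P j)^[k j] f)
      (hagedornGaussian Q P s) t

end

section HagedornSTFT

open scoped SchwartzMap LineDeriv FourierTransform Nat

/-! ### Gaussians as Schwartz functions -/

/-! Everything rests on the covariance of the short-time Fourier transform under first order
operators (`stft_heisenbergOp`). An operator applied to `f` can be moved to the window, at the price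
of a scalar that is linear in `(x, ω)`. Under this move the raising operator `A†_j` of the frame
becomes the lowering operator `A_j` with scalar `√π conj ζ_j`, and `A_j` becomes `A†_j` with scalar
`√π ζ_j`.

The two frame identities are exactly the canonical commutation relations for `A_j`, `A†_j`, and
`A_j` annihilates the Gaussian. Hence the transforms of unnormalized ladder states obey a recursion
in `(k, n)` whose solution is the Gaussian transform times a product of two-variable Hermite sums
(`eq_mul_prod_hermiteTwo`, `stft_ladder`). These sums are conjugates of `complexHermite` up to
factorials (`conj_complexHermite`).

For the Gaussian itself, write `Im (P Q⁻¹) = Wᵀ W` with `W Q` unitary (`exists_sqrt`). The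
substitution `y = W u` reduces the integral to a standard one, and unitarity of `W Q` turns the
exponent into `‖ζ‖²` (`norm_sq_phase`). The modulus statement follows by comparison with the frame
`(1, i)`, whose wavepackets are the product Hermite functions.

All operators act on Schwartz space, so no separate integrability or smoothness conditions have to
be tracked. -/

theorem norm_iteratedFDeriv_cexp_le (n : ℕ) (z : ℂ) :
    ‖iteratedFDeriv ℝ n Complex.exp z‖ ≤ ‖Complex.exp z‖ := by
  induction n with
  | zero => simp
  | succ n ih =>
    -- Since `exp` is its own derivative up to the map `mul`, of norm at most `1`, each further
    -- derivative costs nothing.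
    have h : fderiv ℝ Complex.exp = ContinuousLinearMap.mul ℝ ℂ ∘ Complex.exp := by
      ext1 w
      rw [((Complex.hasDerivAt_exp w).hasFDerivAt.restrictScalars ℝ).fderiv]
      ext
      simp [mul_comm]
    rw [← norm_iteratedFDeriv_fderiv, h]
    calc _ ≤ ‖ContinuousLinearMap.mul ℝ ℂ‖ * ‖iteratedFDeriv ℝ n Complex.exp z‖ :=
          ContinuousLinearMap.norm_iteratedFDeriv_comp_left _
            (Complex.contDiff_exp (𝕜 := ℝ) (n := n)).contDiffAt le_rfl
      _ ≤ 1 * ‖Complex.exp z‖ :=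
          mul_le_mul (ContinuousLinearMap.opNorm_mul_le ℝ ℂ) ih (norm_nonneg _) zero_le_one
      _ = _ := one_mul _

/-- From `1 + r ≤ exp r` the exponent is at most `N r - c r²`; completing the square gives the
constant. -/
theorem one_add_pow_mul_exp_neg_le {c : ℝ} (hc : 0 < c) (N : ℕ) {r : ℝ} (hr : 0 ≤ r) :
    (1 + r) ^ N * Real.exp (-c * r ^ 2) ≤ Real.exp (N ^ 2 / (4 * c)) := by
  have h1 : (1 + r) ^ N ≤ Real.exp (N * r) := by
    rw [Real.exp_nat_mul]
    exact pow_le_pow_left₀ (by positivity) (by linarith [Real.add_one_le_exp r]) N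
  refine (mul_le_mul_of_nonneg_right h1 (Real.exp_pos _).le).trans ?_
  rw [← Real.exp_add, Real.exp_le_exp, le_div_iff₀ (by positivity)]
  nlinarith [sq_nonneg (2 * c * r - N)]

/-- The Schwartz function `exp ∘ q`, for a function `q` of temperate growth whose real part is
bounded above by a negative definite quadratic form. -/
noncomputable def expSchwartz {E : Type*} [NormedAddCommGroup E] [NormedSpace ℝ E] (q : E → ℂ)
    (hq : q.HasTemperateGrowth) (hc : ∃ c : ℝ, 0 < c ∧ ∀ x, (q x).re ≤ -c * ‖x‖ ^ 2) :
    𝓢(E, ℂ) where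
  toFun := Complex.exp ∘ q
  smooth' := Complex.contDiff_exp.comp hq.1
  decay' k n := by
    obtain ⟨c, hc, hqc⟩ := hc
    obtain ⟨m, C, hC, hb⟩ := hq.norm_iteratedFDeriv_le_uniform n
    refine ⟨n ! * (1 + C) ^ n * Real.exp ((k + m * n : ℕ) ^ 2 / (4 * c)), fun x => ?_⟩
    have h1 : (1 : ℝ) ≤ (1 + ‖x‖) ^ m := one_le_pow₀ (by linarith [norm_nonneg x])
    -- The factor `1 + C` instead of `C` makes the base at least `1`, so that `D ≤ D ^ i` for `i ≥
    -- 1`, as the Faà di Bruno bound requires.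
    have hD : 1 ≤ (1 + C) * (1 + ‖x‖) ^ m := by nlinarith
    have key := norm_iteratedFDeriv_comp_le (𝕜 := ℝ) (g := Complex.exp) (f := q) (n := n)
      (N := ((⊤ : ℕ∞) : WithTop ℕ∞)) Complex.contDiff_exp hq.1 (by exact_mod_cast le_top) x
      (C := Real.exp (-c * ‖x‖ ^ 2)) (D := (1 + C) * (1 + ‖x‖) ^ m)
      (fun i _ => (norm_iteratedFDeriv_cexp_le i _).trans (by
        rw [Complex.norm_exp]; exact Real.exp_le_exp.2 (hqc x)))
      (fun i hi hin => (hb i hin x).trans (le_trans (by nlinarith) (le_self_pow₀ hD (by omega))))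
    calc _ ≤ (1 + ‖x‖) ^ k * (n ! * Real.exp (-c * ‖x‖ ^ 2) * ((1 + C) * (1 + ‖x‖) ^ m) ^ n) := by
          gcongr; linarith
      _ = n ! * (1 + C) ^ n * ((1 + ‖x‖) ^ (k + m * n) * Real.exp (-c * ‖x‖ ^ 2)) := by
          rw [mul_pow, ← pow_mul, pow_add]; ring
      _ ≤ _ := by
          gcongr
          exact one_add_pow_mul_exp_neg_le hc _ (norm_nonneg x)

/-! ### Position and momentum operators on Schwartz functions -/

section Operators

variable {d : ℕ}

theorem hasTemperateGrowth_coord (l : Fin d) :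
    (fun t : EuclideanSpace ℝ (Fin d) => (t l : ℂ)).HasTemperateGrowth :=
  (Complex.ofRealCLM ∘L
    (EuclideanSpace.proj l : EuclideanSpace ℝ (Fin d) →L[ℝ] ℝ)).hasTemperateGrowth

/-- Multiplication by the `l`-th coordinate. -/
noncomputable def coordMul (l : Fin d) :
    𝓢(EuclideanSpace ℝ (Fin d), ℂ) →ₗ[ℂ] 𝓢(EuclideanSpace ℝ (Fin d), ℂ) :=
  (SchwartzMap.smulLeftCLM ℂ fun t : EuclideanSpace ℝ (Fin d) => (t l : ℂ)).toLinearMap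

/-- The `l`-th partial derivative. -/
noncomputable def coordDeriv (l : Fin d) :
    𝓢(EuclideanSpace ℝ (Fin d), ℂ) →ₗ[ℂ] 𝓢(EuclideanSpace ℝ (Fin d), ℂ) :=
  (LineDeriv.lineDerivOpCLM ℂ 𝓢(EuclideanSpace ℝ (Fin d), ℂ)
    (EuclideanSpace.single l (1 : ℝ))).toLinearMap

@[simp]
theorem coordMul_apply (l : Fin d) (f : 𝓢(EuclideanSpace ℝ (Fin d), ℂ))
    (t : EuclideanSpace ℝ (Fin d)) : coordMul l f t = t l * f t :=
  SchwartzMap.smulLeftCLM_apply_apply (hasTemperateGrowth_coord l) f t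

@[simp]
theorem coordDeriv_apply (l : Fin d) (f : 𝓢(EuclideanSpace ℝ (Fin d), ℂ))
    (t : EuclideanSpace ℝ (Fin d)) :
    coordDeriv l f t = fderiv ℝ f t (EuclideanSpace.single l (1 : ℝ)) := rfl

theorem hasFDerivAt_coord (l : Fin d) (t : EuclideanSpace ℝ (Fin d)) :
    HasFDerivAt (fun t : EuclideanSpace ℝ (Fin d) => (t l : ℂ))
      (Complex.ofRealCLM ∘L (EuclideanSpace.proj l : EuclideanSpace ℝ (Fin d) →L[ℝ] ℝ)) t :=
  (Complex.ofRealCLM ∘L (EuclideanSpace.proj l : EuclideanSpace ℝ (Fin d) →L[ℝ] ℝ)).hasFDerivAt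

theorem coordDeriv_coordMul (l m : Fin d) (f : 𝓢(EuclideanSpace ℝ (Fin d), ℂ)) :
    coordDeriv l (coordMul m f) =
      coordMul m (coordDeriv l f) + (if l = m then (1 : ℂ) else 0) • f := by
  ext t
  have h : HasFDerivAt (coordMul m f) _ t :=
    ((hasFDerivAt_coord m t).mul (f.hasFDerivAt t)).congr_of_eventuallyEq
      (Filter.Eventually.of_forall fun t => coordMul_apply m f t)
  rw [coordDeriv_apply, h.fderiv]
  by_cases hlm : l = m
  · subst hlm; simp
  · simp [hlm, Ne.symm hlm]

theorem coordDeriv_comm (l m : Fin d) (f : 𝓢(EuclideanSpace ℝ (Fin d), ℂ)) :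
    coordDeriv l (coordDeriv m f) = coordDeriv m (coordDeriv l f) := by
  ext t
  have h2 : IsSymmSndFDerivAt ℝ f t :=
    (f.smooth 2).contDiffAt.isSymmSndFDerivAt (by simp)
  have hd (v w : EuclideanSpace ℝ (Fin d)) :
      fderiv ℝ (fun s => fderiv ℝ f s v) t w = fderiv ℝ (fderiv ℝ f) t w v := by
    have : DifferentiableAt ℝ (fderiv ℝ f) t :=
      ((f.smooth 2).fderiv_right (m := 1) (by norm_num)).differentiable one_ne_zero t
    rw [((this.hasFDerivAt).clm_apply (hasFDerivAt_const v t)).fderiv]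
    simp
  exact (hd _ _).trans ((h2 _ _).trans (hd _ _).symm)

theorem coordMul_comm (l m : Fin d) (f : 𝓢(EuclideanSpace ℝ (Fin d), ℂ)) :
    coordMul l (coordMul m f) = coordMul m (coordMul l f) := by
  ext t
  simp only [coordMul_apply]
  ring

/-- The first order operator `∑ l, (a l * t_l + b l * ∂_l)`. -/
noncomputable def heisenbergOp (a b : Fin d → ℂ) :
    𝓢(EuclideanSpace ℝ (Fin d), ℂ) →ₗ[ℂ] 𝓢(EuclideanSpace ℝ (Fin d), ℂ) :=
  ∑ l, (a l • coordMul l + b l • coordDeriv l)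

theorem heisenbergOp_eq_sum (a b : Fin d → ℂ) (f : 𝓢(EuclideanSpace ℝ (Fin d), ℂ)) :
    heisenbergOp a b f = ∑ l, (a l • coordMul l f + b l • coordDeriv l f) := by
  simp [heisenbergOp]

theorem heisenbergOp_apply (a b : Fin d → ℂ) (f : 𝓢(EuclideanSpace ℝ (Fin d), ℂ))
    (t : EuclideanSpace ℝ (Fin d)) :
    heisenbergOp a b f t =
      ∑ l, (a l * (t l * f t) + b l * fderiv ℝ f t (EuclideanSpace.single l (1 : ℝ))) := by
  rw [heisenbergOp_eq_sum, _root_.sum_apply]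
  simp

theorem heisenbergOp_coordMul (a b : Fin d → ℂ) (m : Fin d)
    (f : 𝓢(EuclideanSpace ℝ (Fin d), ℂ)) :
    heisenbergOp a b (coordMul m f) = coordMul m (heisenbergOp a b f) + b m • f := by
  simp only [heisenbergOp_eq_sum, map_sum, map_add, map_smul, coordDeriv_coordMul,
    coordMul_comm _ m, smul_add, ← add_assoc, Finset.sum_add_distrib]
  simp

theorem heisenbergOp_coordDeriv (a b : Fin d → ℂ) (m : Fin d)
    (f : 𝓢(EuclideanSpace ℝ (Fin d), ℂ)) :
    heisenbergOp a b (coordDeriv m f) = coordDeriv m (heisenbergOp a b f) - a m • f := by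
  simp only [heisenbergOp_eq_sum, map_sum, map_add, map_smul, coordDeriv_coordMul,
    coordDeriv_comm _ m, smul_add, Finset.sum_add_distrib]
  simp
  abel

/-- The canonical commutation relations. -/
theorem heisenbergOp_comm (a b a' b' : Fin d → ℂ) (f : 𝓢(EuclideanSpace ℝ (Fin d), ℂ)) :
    heisenbergOp a b (heisenbergOp a' b' f) =
      heisenbergOp a' b' (heisenbergOp a b f) + (∑ l, (a' l * b l - b' l * a l)) • f := by
  -- Only the primed operator is expanded; the other one is pushed through each `t_m` and `∂_m` by
  -- its commutators `b m` and `-a m`.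
  rw [heisenbergOp_eq_sum a' b' f, heisenbergOp_eq_sum a' b']
  simp only [map_sum, map_add, map_smul, heisenbergOp_coordMul, heisenbergOp_coordDeriv,
    Finset.sum_smul, ← Finset.sum_add_distrib]
  refine Finset.sum_congr rfl fun l _ => ?_
  module

end Operators

/-! ### The short-time Fourier transform of Schwartz functions -/

section STFT

variable {d : ℕ}

/-- The Schwartz function `t ↦ f(t) conj(g(t - x))`. -/
noncomputable def windowed (x : EuclideanSpace ℝ (Fin d)) (g f : 𝓢(EuclideanSpace ℝ (Fin d), ℂ)) :
    𝓢(EuclideanSpace ℝ (Fin d), ℂ) :=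
  SchwartzMap.pairing (ContinuousLinearMap.mul ℂ ℂ) f
    (SchwartzMap.postcompCLM (Complex.conjCLE : ℂ →L[ℝ] ℂ) (SchwartzMap.compSubConstCLM ℝ x g))

@[simp]
theorem windowed_apply (x : EuclideanSpace ℝ (Fin d)) (g f : 𝓢(EuclideanSpace ℝ (Fin d), ℂ))
    (t : EuclideanSpace ℝ (Fin d)) : windowed x g f t = f t * conj (g (t - x)) := by
  simp [windowed]

theorem stft_eq_fourier (g f : 𝓢(EuclideanSpace ℝ (Fin d), ℂ)) (x ω : EuclideanSpace ℝ (Fin d)) :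
    stft g f x ω = 𝓕 (windowed x g f) ω := by
  rw [SchwartzMap.fourier_coe, Real.fourier_eq', stft]
  refine integral_congr_ae (Filter.Eventually.of_forall fun t => ?_)
  simp only [windowed_apply, smul_eq_mul]
  rw [mul_comm]
  congr 2
  rw [real_inner_comm]
  push_cast
  ring

theorem coordDeriv_windowed (x : EuclideanSpace ℝ (Fin d)) (l : Fin d)
    (g f : 𝓢(EuclideanSpace ℝ (Fin d), ℂ)) :
    coordDeriv l (windowed x g f) =
      windowed x g (coordDeriv l f) + windowed x (coordDeriv l g) f := by
  ext t
  have hg : HasFDerivAt (fun s => conj (g (s - x)))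
      ((Complex.conjCLE : ℂ →L[ℝ] ℂ) ∘L fderiv ℝ g (t - x)) t :=
    (Complex.conjCLE : ℂ →L[ℝ] ℂ).hasFDerivAt.comp t
      ((g.hasFDerivAt (t - x)).comp t ((hasFDerivAt_id t).sub_const x))
  have h : HasFDerivAt (windowed x g f) _ t :=
    ((f.hasFDerivAt t).mul hg).congr_of_eventuallyEq
      (Filter.Eventually.of_forall fun t => windowed_apply x g f t)
  rw [coordDeriv_apply, h.fderiv]
  simp
  ring

/-- Write `t_l = (t_l - x_l) + x_l` and use the Leibniz rule for `∂_l`. The conjugates appear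
because the window enters conjugated, the sign because the derivative changes factor. -/
theorem windowed_heisenbergOp (x : EuclideanSpace ℝ (Fin d)) (a b : Fin d → ℂ)
    (g f : 𝓢(EuclideanSpace ℝ (Fin d), ℂ)) :
    windowed x g (heisenbergOp a b f) =
      windowed x (heisenbergOp (fun l => conj (a l)) (fun l => -conj (b l)) g) f +
        ∑ l, ((a l * x l) • windowed x g f + b l • coordDeriv l (windowed x g f)) := by
  ext t
  simp only [coordDeriv_windowed, _root_.add_apply, _root_.sum_apply, windowed_apply,
    heisenbergOp_apply, map_sum, Finset.sum_mul, Finset.mul_sum, ← Finset.sum_add_distrib]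
  refine Finset.sum_congr rfl fun l _ => ?_
  simp
  ring

theorem fourier_coordDeriv (l : Fin d) (f : 𝓢(EuclideanSpace ℝ (Fin d), ℂ))
    (ω : EuclideanSpace ℝ (Fin d)) :
    𝓕 (coordDeriv l f) ω = 2 * Real.pi * Complex.I * ω l * 𝓕 f ω := by
  change 𝓕 (∂_{EuclideanSpace.single l (1 : ℝ)} f) ω = _
  rw [SchwartzMap.fourier_lineDerivOp_eq]
  have h : (inner ℝ · (EuclideanSpace.single l (1 : ℝ)) :
      EuclideanSpace ℝ (Fin d) → ℝ).HasTemperateGrowth :=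
    ((innerSL ℝ).flip (EuclideanSpace.single l (1 : ℝ))).hasTemperateGrowth
  rw [_root_.smul_apply, SchwartzMap.smulLeftCLM_apply_apply h]
  simp [EuclideanSpace.inner_single_right, mul_assoc]

/-- Covariance of the short-time Fourier transform under first order operators. -/
theorem stft_heisenbergOp (a b : Fin d → ℂ) (g f : 𝓢(EuclideanSpace ℝ (Fin d), ℂ))
    (x ω : EuclideanSpace ℝ (Fin d)) :
    stft g (heisenbergOp a b f) x ω =
      stft (heisenbergOp (fun l => conj (a l)) (fun l => -conj (b l)) g) f x ω +
        (∑ l, (a l * x l + 2 * Real.pi * Complex.I * b l * ω l)) * stft g f x ω := by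
  simp only [stft_eq_fourier, windowed_heisenbergOp]
  simp only [← SchwartzMap.fourierTransformCLM_apply ℂ, map_add, map_sum, map_smul,
    _root_.add_apply, _root_.sum_apply, _root_.smul_apply]
  simp only [SchwartzMap.fourierTransformCLM_apply, fourier_coordDeriv, Finset.sum_mul,
    smul_eq_mul]
  congr 1
  refine Finset.sum_congr rfl fun l _ => ?_
  ring

end STFT

/-! ### Complex Hermite polynomials -/

section ComplexHermite

/-- The two-variable Hermite polynomial
`∑ i ≤ n, C(n, i) C(k, i) i! a^(n-i) b^(k-i)`. -/
def hermiteTwo (n k : ℕ) (a b : ℂ) : ℂ :=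
  ∑ i ∈ Finset.range (n + 1),
    (n.choose i : ℂ) * (k.choose i : ℂ) * (i ! : ℂ) * a ^ (n - i) * b ^ (k - i)

@[simp]
theorem hermiteTwo_zero_left (k : ℕ) (a b : ℂ) : hermiteTwo 0 k a b = b ^ k := by
  simp [hermiteTwo]

/-- Formally `hermiteTwo n k a b = (a + ∂_b)^n b^k`, and `∂_b` lowers `k` with factor `k`. The proof
is Pascal's rule in `n` together with `C(k, i+1) (i+1)! = k C(k-1, i) i!`. -/
theorem hermiteTwo_succ_left (n k : ℕ) (a b : ℂ) :
    hermiteTwo (n + 1) k a b = k * hermiteTwo n (k - 1) a b + a * hermiteTwo n k a b := by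
  have h2 : a * hermiteTwo n k a b = ∑ i ∈ Finset.range (n + 2),
      (n.choose i : ℂ) * (k.choose i : ℂ) * (i ! : ℂ) * a ^ (n + 1 - i) * b ^ (k - i) := by
    rw [Finset.sum_range_succ, Nat.choose_succ_self, hermiteTwo, Finset.mul_sum]
    simp only [Nat.cast_zero, zero_mul, add_zero]
    refine Finset.sum_congr rfl fun i hi => ?_
    rw [Nat.succ_sub (by simpa [Nat.lt_succ_iff] using hi), pow_succ]
    ring
  rw [h2, Finset.sum_range_succ', hermiteTwo, Finset.sum_range_succ', hermiteTwo, Finset.mul_sum,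
    ← add_assoc, ← Finset.sum_add_distrib]
  congr 1
  · refine Finset.sum_congr rfl fun i _ => ?_
    have hk : (k.choose (i + 1) : ℂ) * ((i + 1)! : ℂ) = k * ((k - 1).choose i : ℂ) * (i ! : ℂ) := by
      rcases k with _ | k
      · simp
      · have := Nat.add_one_mul_choose_eq k i
        rw [Nat.factorial_succ]
        norm_cast
        rw [Nat.add_sub_cancel, this]
        ring
    rw [Nat.choose_succ_succ, Nat.add_sub_add_right, Nat.sub_sub, Nat.add_comm 1 i]
    push_cast
    linear_combination (n.choose i : ℂ) * a ^ (n - i) * b ^ (k - (i + 1)) * hk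
  · simp

/-- Reversing the sum by `i = k - j` leaves `a ^ (n - k)` times powers of `a * b`; the sign in `ht`
cancels the `(-1) ^ j` of the Laguerre polynomial. -/
theorem sum_eq_laguerreFn {n k : ℕ} (hkn : k ≤ n) (a b : ℂ) (t : ℝ) (ht : (t : ℂ) = -(a * b)) :
    ∑ i ∈ Finset.range (k + 1),
      (k.choose i : ℂ) * (n.choose i : ℂ) * (i ! : ℂ) * a ^ (n - i) * b ^ (k - i) =
      (k ! : ℂ) * a ^ (n - k) * (laguerreFn k (n - k) t : ℂ) := by
  rw [laguerreFn, ← Finset.sum_range_reflect]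
  push_cast
  rw [Finset.mul_sum]
  refine Finset.sum_congr rfl fun j hj => ?_
  have hj : j ≤ k := by simpa [Nat.lt_succ_iff] using hj
  have e2 : k - (k - j) = j := by omega
  have e3 : k + (n - k) = n := by omega
  have e4 : n - (k - j) = (n - k) + j := by omega
  rw [e2, e3, e4, ht, neg_pow (a * b), mul_pow, pow_add]
  have h1 : ((-1 : ℂ) ^ j) * (-1) ^ j = 1 := by rw [← mul_pow]; simp
  have h2 : (k.choose (k - j) : ℂ) * ((k - j)! : ℂ) * (j ! : ℂ) = (k ! : ℂ) := by
    have := Nat.choose_mul_factorial_mul_factorial (Nat.sub_le k j)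
    rw [e2] at this
    exact_mod_cast this
  have h3 : (j ! : ℂ) ≠ 0 := by exact_mod_cast j.factorial_ne_zero
  field_simp
  linear_combination (n.choose (k - j) : ℂ) * a ^ (n - k) * a ^ j * b ^ j * h2 -
    (k ! : ℂ) * (n.choose (k - j) : ℂ) * a ^ (n - k) * a ^ j * b ^ j * h1

theorem sqrt_div_mul_sqrt_mul_sqrt {x y : ℝ} (hx : 0 < x) (hy : 0 < y) :
    √(x / y) * (√y * √x) = x := by
  rw [Real.sqrt_div hx.le]
  have : √y ≠ 0 := by positivity
  field_simp
  exact Real.sq_sqrt hx.le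

theorem complexHermite_mul_sqrt (n k : ℕ) (z : ℂ) :
    complexHermite n k z * ((√(n ! : ℝ) : ℝ) * (√(k ! : ℝ) : ℝ)) =
      hermiteTwo n k ((√Real.pi : ℝ) * z) (-((√Real.pi : ℝ) * conj z)) := by
  have hpi : ((√Real.pi : ℝ) : ℂ) * (√Real.pi : ℝ) = (Real.pi : ℝ) := by
    rw [← Complex.ofReal_mul, Real.mul_self_sqrt Real.pi_pos.le]
  have ht : ((Real.pi * ‖z‖ ^ 2 : ℝ) : ℂ) =
      -((√Real.pi : ℝ) * z * (-((√Real.pi : ℝ) * conj z))) := by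
    have := Complex.mul_conj' z
    push_cast
    linear_combination -(‖z‖ : ℂ) ^ 2 * hpi - ((√Real.pi : ℝ) : ℂ) * (√Real.pi : ℝ) * this
  have hn : (0 : ℝ) < (n ! : ℝ) := by exact_mod_cast n.factorial_pos
  have hk : (0 : ℝ) < (k ! : ℝ) := by exact_mod_cast k.factorial_pos
  rw [complexHermite]
  split_ifs with h
  -- For `k < n` the terms with `i > k` vanish. In the other case the full range is kept, and the
  -- roles of `a` and `b` are exchanged.
  · have hs : hermiteTwo n k ((√Real.pi : ℝ) * z) (-((√Real.pi : ℝ) * conj z)) = _ :=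
      (Finset.sum_subset (Finset.range_subset_range.2 (by omega : k + 1 ≤ n + 1))
        (fun i _ hi => by
          rw [Nat.choose_eq_zero_of_lt (n := k) (by simpa using hi)]; simp)).symm
    rw [hs]
    simp only [mul_comm (n.choose _ : ℂ)]
    rw [sum_eq_laguerreFn h.le _ _ _ ht]
    have h1 : ((√((k ! : ℝ) / (n ! : ℝ)) : ℝ) : ℂ) * ((√(n ! : ℝ) : ℝ) * (√(k ! : ℝ) : ℝ)) =
        (k ! : ℂ) := by exact_mod_cast sqrt_div_mul_sqrt_mul_sqrt hk hn
    rw [mul_pow, ← h1]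
    push_cast
    ring
  · have h := not_lt.1 h
    rw [hermiteTwo]
    simp only [mul_right_comm _ ((((√Real.pi : ℝ) : ℂ) * z) ^ _) _]
    rw [sum_eq_laguerreFn h _ _ _ (by rw [ht]; ring)]
    have h1 : ((√((n ! : ℝ) / (k ! : ℝ)) : ℝ) : ℂ) * ((√(n ! : ℝ) : ℝ) * (√(k ! : ℝ) : ℝ)) =
        (n ! : ℂ) := by
      rw [mul_comm ((√(n ! : ℝ) : ℝ) : ℂ)]
      exact_mod_cast sqrt_div_mul_sqrt_mul_sqrt hn hk
    rw [neg_pow (((√Real.pi : ℝ) : ℂ) * conj z), mul_pow, ← h1]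
    push_cast
    ring

theorem conj_complexHermite (n k : ℕ) (z : ℂ) :
    conj (complexHermite n k z) =
      hermiteTwo n k ((√Real.pi : ℝ) * conj z) (-((√Real.pi : ℝ) * z)) /
        ((√(n ! : ℝ) : ℝ) * (√(k ! : ℝ) : ℝ)) := by
  have hn : ((√(n ! : ℝ) : ℝ) : ℂ) ≠ 0 := by
    rw [Complex.ofReal_ne_zero, Real.sqrt_ne_zero']; exact_mod_cast n.factorial_pos
  have hk : ((√(k ! : ℝ) : ℝ) : ℂ) ≠ 0 := by
    rw [Complex.ofReal_ne_zero, Real.sqrt_ne_zero']; exact_mod_cast k.factorial_pos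
  rw [eq_div_iff (mul_ne_zero hn hk)]
  have := congrArg conj (complexHermite_mul_sqrt n k z)
  simpa [hermiteTwo] using this

end ComplexHermite

/-! ### Ladders of raising and lowering operators -/

section Ladder

theorem Pi.induction_add_single {ι : Type*} [Fintype ι] [DecidableEq ι] {p : (ι → ℕ) → Prop}
    (h0 : p 0) (h1 : ∀ k j, p k → p (k + Pi.single j 1)) (k : ι → ℕ) : p k := by
  induction hN : ∑ i, k i generalizing k with
  | zero =>
    have : k = 0 := funext fun i => by simpa using Finset.sum_eq_zero_iff.1 hN i (Finset.mem_univ i)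
    exact this ▸ h0
  | succ N ih =>
    obtain ⟨j, -, hj⟩ : ∃ j ∈ Finset.univ, k j ≠ 0 :=
      Finset.exists_ne_zero_of_sum_ne_zero (by omega)
    have hk : k - Pi.single j 1 + Pi.single j 1 = k := by
      funext i
      by_cases hi : i = j
      · subst hi; simp; omega
      · simp [hi]
    rw [← hk]
    refine h1 _ j (ih _ ?_)
    have := congrArg (fun k : ι → ℕ => ∑ i, k i) hk
    have h1 : ∑ i, (Pi.single j 1 : ι → ℕ) i = 1 := by simp [Pi.single_apply]
    simp only [Pi.add_apply, Finset.sum_add_distrib] at this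
    omega

/-- Apply `R j` to `v` repeatedly, `k j` times for every `j` in the list. -/
def ladderList {ι M : Type*} (R : ι → M → M) (v : M) (k : ι → ℕ) (l : List ι) : M :=
  l.foldr (fun j f => (R j)^[k j] f) v

theorem ladderList_add_single_of_notMem {ι M : Type*} [DecidableEq ι] (R : ι → M → M) (v : M)
    (k : ι → ℕ) (j : ι) {l : List ι} (hj : j ∉ l) :
    ladderList R v (k + Pi.single j 1 : ι → ℕ) l = ladderList R v k l := by
  refine List.foldr_ext _ _ _ fun i hi w => ?_
  have : i ≠ j := fun h => hj (h ▸ hi)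
  simp [this]

/-- Because the operators commute, the extra `R j` can be pulled to the front; without repetitions
in the list it arises only once. -/
theorem ladderList_add_single {ι M : Type*} [DecidableEq ι] (R : ι → M → M)
    (hR : ∀ i j, Function.Commute (R i) (R j)) (v : M) (k : ι → ℕ) (j : ι) {l : List ι}
    (hl : l.Nodup) (hj : j ∈ l) :
    ladderList R v (k + Pi.single j 1 : ι → ℕ) l = R j (ladderList R v k l) := by
  induction l with
  | nil => simp at hj
  | cons i l ih =>
    rw [List.nodup_cons] at hl
    change (R i)^[(k + Pi.single j 1 : ι → ℕ) i] (ladderList R v (k + Pi.single j 1) l) =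
      R j ((R i)^[k i] (ladderList R v k l))
    rcases List.mem_cons.1 hj with rfl | hj'
    · rw [ladderList_add_single_of_notMem _ _ _ _ hl.1, ← Function.iterate_succ_apply' (R j)]
      simp
    · have hij : i ≠ j := fun h => hl.1 (h ▸ hj')
      rw [ih hl.2 hj', Pi.add_apply, Pi.single_eq_of_ne hij, add_zero,
        ((hR i j).iterate_left (k i)).eq]

variable {d : ℕ} {M : Type*} [AddCommGroup M] [Module ℂ M]

/-- The state `(R 0)^(k 0) (⋯ ((R (d-1))^(k (d-1)) v))`. -/
def ladder (R : Fin d → M →ₗ[ℂ] M) (v : M) (k : Fin d → ℕ) : M :=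
  ladderList (fun j => R j) v k (List.finRange d)

@[simp]
theorem ladder_zero (R : Fin d → M →ₗ[ℂ] M) (v : M) : ladder R v 0 = v := by
  simp [ladder, ladderList]

theorem ladder_add_single {R : Fin d → M →ₗ[ℂ] M} (hR : ∀ i j f, R i (R j f) = R j (R i f))
    (v : M) (k : Fin d → ℕ) (j : Fin d) : ladder R v (k + Pi.single j 1) = R j (ladder R v k) :=
  ladderList_add_single (fun j => R j) (fun i j => hR i j) v k j (List.nodup_finRange d)
    (List.mem_finRange j)

/-- By the commutation relations `A j` acts on ladder states as `∂/∂X_j` acts on monomials. -/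
theorem lower_ladder {R A : Fin d → M →ₗ[ℂ] M} (hR : ∀ i j f, R i (R j f) = R j (R i f))
    (hA : ∀ i j f, A i (R j f) = R j (A i f) + (if i = j then (1 : ℂ) else 0) • f)
    {v : M} (hv : ∀ j, A j v = 0) (k : Fin d → ℕ) (j : Fin d) :
    A j (ladder R v k) = (k j : ℂ) • ladder R v (k - Pi.single j 1) := by
  induction k using Pi.induction_add_single with
  | h0 => simp [hv]
  | h1 k i ih =>
    rw [ladder_add_single hR, hA, ih, map_smul]
    by_cases hij : j = i
    · subst hij
      rw [if_pos rfl]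
      have e : k + Pi.single j 1 - Pi.single j 1 = k := add_tsub_cancel_right _ _
      rw [e]
      -- Truncated subtraction: `k - e_j + e_j = k` fails when `k j = 0`, but then the coefficient
      -- is zero.
      by_cases hk : k j = 0
      · simp [hk]
      · rw [← ladder_add_single hR]
        have e2 : k - Pi.single j 1 + Pi.single j 1 = k := by
          funext i
          by_cases hi : i = j
          · subst hi; simp; omega
          · simp [hi]
        rw [e2]
        simp [add_smul]
    · have e : k + Pi.single i 1 - Pi.single j 1 = k - Pi.single j 1 + Pi.single i 1 := by
        funext l
        by_cases hl : l = j
        · subst hl; simp [hij]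
        · simp [hl]
      rw [e, ladder_add_single hR]
      simp [hij]

/-- A function of two multi-indices satisfying the ladder recursions is a product of
two-variable Hermite polynomials. -/
theorem eq_mul_prod_hermiteTwo (U : (Fin d → ℕ) → (Fin d → ℕ) → ℂ) (a b : Fin d → ℂ)
    (h1 : ∀ k n j, U k (n + Pi.single j 1) = k j * U (k - Pi.single j 1) n + a j * U k n)
    (h2 : ∀ k j, U (k + Pi.single j 1) 0 = b j * U k 0) (k n : Fin d → ℕ) :
    U k n = U 0 0 * ∏ j, hermiteTwo (n j) (k j) (a j) (b j) := by
  induction n using Pi.induction_add_single generalizing k with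
  | h0 =>
    induction k using Pi.induction_add_single with
    | h0 => simp
    | h1 k j ih =>
      have e : ∏ i ∈ Finset.univ.erase j,
          hermiteTwo ((0 : Fin d → ℕ) i) ((k + Pi.single j 1 : Fin d → ℕ) i) (a i) (b i) =
          ∏ i ∈ Finset.univ.erase j, hermiteTwo ((0 : Fin d → ℕ) i) (k i) (a i) (b i) :=
        Finset.prod_congr rfl fun i hi => by simp [Finset.ne_of_mem_erase hi]
      rw [h2, ih]
      simp only [← Finset.mul_prod_erase _ _ (Finset.mem_univ j)]
      rw [e]
      simp [pow_succ]
      ring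
  | h1 n j ih =>
    have e1 : ∏ i ∈ Finset.univ.erase j,
        hermiteTwo (n i) ((k - Pi.single j 1 : Fin d → ℕ) i) (a i) (b i) =
        ∏ i ∈ Finset.univ.erase j, hermiteTwo (n i) (k i) (a i) (b i) :=
      Finset.prod_congr rfl fun i hi => by simp [Finset.ne_of_mem_erase hi]
    have e2 : ∏ i ∈ Finset.univ.erase j,
        hermiteTwo ((n + Pi.single j 1 : Fin d → ℕ) i) (k i) (a i) (b i) =
        ∏ i ∈ Finset.univ.erase j, hermiteTwo (n i) (k i) (a i) (b i) :=
      Finset.prod_congr rfl fun i hi => by simp [Finset.ne_of_mem_erase hi]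
    rw [h1, ih, ih]
    simp only [← Finset.mul_prod_erase _ _ (Finset.mem_univ j)]
    rw [e1, e2]
    simp only [Pi.add_apply, Pi.sub_apply, Pi.single_eq_same, hermiteTwo_succ_left]
    ring

end Ladder

/-! ### Lagrangian frames -/

section Frames

variable {d : ℕ} {Q P : Matrix (Fin d) (Fin d) ℂ}

theorem IsLagrangianFrame.sum_symm (h : IsLagrangianFrame Q P) (i j : Fin d) :
    ∑ l, (Q l i * P l j - P l i * Q l j) = 0 := by
  have := congrFun (congrFun h.symm i) j
  simpa [Matrix.mul_apply] using this

theorem IsLagrangianFrame.sum_normalized (h : IsLagrangianFrame Q P) (i j : Fin d) :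
    ∑ l, (conj (Q l i) * P l j - conj (P l i) * Q l j) =
      2 * Complex.I * (if i = j then 1 else 0) := by
  have := congrFun (congrFun h.normalized i) j
  simpa [Matrix.mul_apply, Matrix.one_apply] using this

/-- Sums and differences of the real parts of the two frame identities, and likewise of the
imaginary parts, give the block conditions. -/
theorem IsLagrangianFrame.frameMatrix_mem_symplecticGroup (h : IsLagrangianFrame Q P) :
    frameMatrix Q P ∈ Matrix.symplecticGroup (Fin d) ℝ := by
  have h1 (i j : Fin d) := congrArg Complex.re (h.sum_symm i j)
  have h2 (i j : Fin d) := congrArg Complex.im (h.sum_symm i j)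
  have h3 (i j : Fin d) := congrArg Complex.re (h.sum_normalized i j)
  have h4 (i j : Fin d) := congrArg Complex.im (h.sum_normalized i j)
  simp only [Complex.re_sum, Complex.im_sum, Complex.sub_re, Complex.sub_im, Complex.mul_re,
    Complex.mul_im, Complex.conj_re, Complex.conj_im, Complex.zero_re, Complex.zero_im,
    Finset.sum_sub_distrib, Finset.sum_add_distrib, neg_mul, Finset.sum_neg_distrib] at h1 h2 h3 h4
  rw [frameMatrix, SymplecticGroup.fromBlocks_mem_iff]
  refine ⟨?_, ?_, ?_⟩ <;> ext i j <;>
    simp only [Matrix.mul_apply, Matrix.transpose_apply, Matrix.map_apply, Matrix.sub_apply,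
      Matrix.one_apply] <;>
    have h1 := h1 i j <;> have h2 := h2 i j <;> have h3 := h3 i j <;> have h4 := h4 i j <;>
    by_cases hij : i = j <;> simp [hij] at h1 h2 h3 h4 ⊢ <;> linarith

/-- The inverse of a symplectic `T` is `-J Tᵀ J`, here with blocks `Im Pᵀ`, `-Im Qᵀ`, `-Re Pᵀ`, `Re
Qᵀ`. -/
theorem phaseToComplex_frameMatrix_inv (h : IsLagrangianFrame Q P)
    (x ω : EuclideanSpace ℝ (Fin d)) (j : Fin d) :
    phaseToComplex (phaseMulVec (frameMatrix Q P)⁻¹ (x, ω)) j =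
      -Complex.I * (Pᵀ *ᵥ fun i => (x i : ℂ)) j + Complex.I * (Qᵀ *ᵥ fun i => (ω i : ℂ)) j := by
  rw [SymplecticGroup.inv_eq_symplectic_inv _ h.frameMatrix_mem_symplecticGroup, frameMatrix,
    Matrix.fromBlocks_transpose, Matrix.J, Matrix.fromBlocks_neg, Matrix.fromBlocks_multiply,
    Matrix.fromBlocks_multiply]
  simp only [phaseToComplex, phaseMulVec, Matrix.fromBlocks_mulVec]
  apply Complex.ext <;>
  simp [Matrix.mulVec, dotProduct]

theorem IsLagrangianFrame.isUnit_det (h : IsLagrangianFrame Q P) : IsUnit Q.det :=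
  (Matrix.isUnit_iff_isUnit_det Q).1 h.isUnit_left

theorem IsLagrangianFrame.transpose_mul (h : IsLagrangianFrame Q P) :
    Qᵀ * (P * Q⁻¹) = Pᵀ := by
  rw [← Matrix.mul_assoc, sub_eq_zero.1 h.symm, Matrix.mul_assoc,
    Matrix.mul_nonsing_inv _ h.isUnit_det, Matrix.mul_one]

theorem IsLagrangianFrame.transpose_mul_inv (h : IsLagrangianFrame Q P) :
    (P * Q⁻¹)ᵀ = P * Q⁻¹ := by
  rw [Matrix.transpose_mul, ← h.transpose_mul, ← Matrix.mul_assoc, ← Matrix.transpose_mul,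
    Matrix.mul_nonsing_inv _ h.isUnit_det, Matrix.transpose_one, Matrix.one_mul]

/-- Multiply the normalization by `(Q⁻¹)ᴴ` and `Q⁻¹` on the two sides. As `P Q⁻¹` is symmetric, its
adjoint is its entrywise conjugate. -/
theorem IsLagrangianFrame.im_mul_inv (h : IsLagrangianFrame Q P) :
    ((P * Q⁻¹).map Complex.im).map Complex.ofRealHom = (Q⁻¹)ᴴ * Q⁻¹ := by
  have h1 : P * Q⁻¹ - (P * Q⁻¹)ᴴ = (2 * Complex.I) • ((Q⁻¹)ᴴ * Q⁻¹) := by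
    have h2 := congrArg (fun M => (Q⁻¹)ᴴ * M * Q⁻¹) h.normalized
    have h3 : (Q⁻¹)ᴴ * Qᴴ = 1 := by
      rw [← Matrix.conjTranspose_mul, Matrix.mul_nonsing_inv _ h.isUnit_det,
        Matrix.conjTranspose_one]
    simp only [Matrix.mul_sub, Matrix.sub_mul, ← Matrix.mul_assoc, h3, Matrix.one_mul,
      Matrix.mul_smul, Matrix.smul_mul, Matrix.mul_one] at h2
    rwa [Matrix.mul_assoc _ Q, Matrix.mul_nonsing_inv _ h.isUnit_det, Matrix.mul_one,
      ← Matrix.conjTranspose_mul] at h2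
  ext i j
  have h2 := congrFun (congrFun h1 i) j
  have h4 : (P * Q⁻¹)ᴴ i j = conj ((P * Q⁻¹) i j) := by
    conv_rhs => rw [← h.transpose_mul_inv]
    rfl
  rw [Matrix.sub_apply, h4, Complex.sub_conj, Matrix.smul_apply, smul_eq_mul] at h2
  have h5 : (2 * Complex.I) ≠ 0 := by simp
  apply mul_left_cancel₀ h5
  rw [← h2]
  simp
  ring

open scoped MatrixOrder Matrix.Norms.L2Operator in
/-- The imaginary part of `P Q⁻¹` is `Wᵀ W` for a real matrix `W` such that `W Q` is unitary. -/
theorem IsLagrangianFrame.exists_sqrt (h : IsLagrangianFrame Q P) :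
    ∃ W : Matrix (Fin d) (Fin d) ℝ, (P * Q⁻¹).map Complex.im = Wᵀ * W ∧
      W.map Complex.ofRealHom * Q ∈ Matrix.unitaryGroup (Fin d) ℂ := by
  -- The real part of `(Q⁻¹)ᴴ Q⁻¹` is a sum of two real Gram matrices.
  have hY : ((P * Q⁻¹).map Complex.im).PosSemidef := by
    have : (P * Q⁻¹).map Complex.im =
        (Q⁻¹.map Complex.re)ᴴ * Q⁻¹.map Complex.re +
          (Q⁻¹.map Complex.im)ᴴ * Q⁻¹.map Complex.im := by
      ext i j
      have h1 := congrArg Complex.re (congrFun (congrFun h.im_mul_inv i) j)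
      rw [Matrix.mul_apply, Complex.re_sum] at h1
      simpa [Matrix.mul_apply, Finset.sum_add_distrib] using h1
    rw [this]
    exact (Matrix.posSemidef_conjTranspose_mul_self _).add
      (Matrix.posSemidef_conjTranspose_mul_self _)
  obtain ⟨W, hW⟩ := CStarAlgebra.nonneg_iff_eq_star_mul_self.mp hY.nonneg
  rw [Matrix.star_eq_conjTranspose, Matrix.conjTranspose_eq_transpose_of_trivial] at hW
  refine ⟨W, hW, ?_⟩
  have h1 := h.im_mul_inv
  rw [hW, Matrix.map_mul] at h1
  have h2 : (W.map Complex.ofRealHom)ᴴ = Wᵀ.map Complex.ofRealHom := by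
    ext i j; simp
  rw [Matrix.mem_unitaryGroup_iff', Matrix.star_eq_conjTranspose, Matrix.conjTranspose_mul, h2,
    Matrix.mul_assoc, ← Matrix.mul_assoc _ _ Q, h1, Matrix.mul_assoc,
    Matrix.nonsing_inv_mul _ h.isUnit_det, Matrix.mul_one, ← Matrix.conjTranspose_mul,
    Matrix.nonsing_inv_mul _ h.isUnit_det, Matrix.conjTranspose_one]

theorem abs_det_mul_norm_det {W : Matrix (Fin d) (Fin d) ℝ}
    (hW : W.map Complex.ofRealHom * Q ∈ Matrix.unitaryGroup (Fin d) ℂ) :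
    |W.det| * ‖Q.det‖ = 1 := by
  have h1 := CStarRing.norm_of_mem_unitary (Matrix.det_of_mem_unitary hW)
  have h2 : (W.map Complex.ofRealHom).det = (W.det : ℂ) := (RingHom.map_det _ _).symm
  rwa [Matrix.det_mul, h2, norm_mul, Complex.norm_real] at h1

/-- The complex quadratic form of a frame in terms of its real and imaginary parts. -/
theorem quadratic_eq {B : Matrix (Fin d) (Fin d) ℂ} {W : Matrix (Fin d) (Fin d) ℝ}
    (hW : B.map Complex.im = Wᵀ * W) (t : EuclideanSpace ℝ (Fin d)) :
    (fun i => (t i : ℂ)) ⬝ᵥ (B *ᵥ fun i => (t i : ℂ)) =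
      ((inner ℝ t (Matrix.toEuclideanCLM (𝕜 := ℝ) (B.map Complex.re) t) : ℝ) : ℂ) +
        Complex.I * ((‖Matrix.toEuclideanCLM (𝕜 := ℝ) W t‖ ^ 2 : ℝ) : ℂ) := by
  have h1 : ‖Matrix.toEuclideanCLM (𝕜 := ℝ) W t‖ ^ 2 = t ⬝ᵥ (B.map Complex.im *ᵥ t) := by
    rw [← real_inner_self_eq_norm_sq, Matrix.inner_toEuclideanCLM, hW, ← Matrix.mulVec_mulVec,
      Matrix.dotProduct_mulVec, Matrix.dotProduct_mulVec, Matrix.vecMul_transpose,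
      Matrix.ofLp_toEuclideanCLM, Matrix.dotProduct_mulVec]
  rw [h1, Matrix.inner_toEuclideanCLM]
  apply Complex.ext <;> simp [dotProduct, Matrix.mulVec]

end Frames

/-! ### The short-time Fourier transform of a Gaussian -/

section GaussianSTFT

variable {d : ℕ}

theorem integral_comp_toEuclideanCLM {W : Matrix (Fin d) (Fin d) ℝ} (hW : W.det ≠ 0)
    (g : EuclideanSpace ℝ (Fin d) → ℂ) :
    ∫ u, g (Matrix.toEuclideanCLM (𝕜 := ℝ) W u) = ((|W.det|⁻¹ : ℝ) : ℂ) * ∫ y, g y := by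
  have hdet : LinearMap.det (Matrix.toEuclideanLin W) = W.det := by
    exact (congrArg LinearMap.det (LinearMap.congr_fun (congrArg LinearEquiv.toLinearMap
      (Matrix.toLpLin_eq_toLin (R := ℝ) 2 2)) W)).trans (LinearMap.det_toLin _ _)
  have hdet' : LinearMap.det (Matrix.toEuclideanLin W) ≠ 0 := hdet ▸ hW
  let e : EuclideanSpace ℝ (Fin d) ≃L[ℝ] EuclideanSpace ℝ (Fin d) :=
    (LinearEquiv.ofIsUnitDet (f := Matrix.toEuclideanLin W)
      (v := (EuclideanSpace.basisFun (Fin d) ℝ).toBasis)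
      (v' := (EuclideanSpace.basisFun (Fin d) ℝ).toBasis)
      (by rw [LinearMap.det_toMatrix]; exact hdet'.isUnit)).toContinuousLinearEquiv
  have h1 : Measure.map e volume = ENNReal.ofReal |W.det⁻¹| • volume := by
    have := Measure.map_linearMap_addHaar_eq_smul_addHaar
      (volume : Measure (EuclideanSpace ℝ (Fin d))) hdet'
    rw [hdet] at this
    exact this
  have h2 := e.toHomeomorph.measurableEmbedding.integral_map (μ := volume) g
  change ∫ y, g y ∂(Measure.map e volume) = _ at h2
  rw [h1, integral_smul_measure, ENNReal.toReal_ofReal (abs_nonneg _), abs_inv] at h2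
  rw [← Complex.real_smul, h2]
  rfl

/-- The hypothesis `hvw` says `Wᵀ w = v`, so the substitution `y = W u` leaves the Fourier integral
of `exp (-2π‖y‖²)` at frequency `w`, up to sign. -/
theorem integral_gaussian_toEuclideanCLM {W : Matrix (Fin d) (Fin d) ℝ} (hW : W.det ≠ 0)
    (v w : EuclideanSpace ℝ (Fin d))
    (hvw : ∀ u, inner ℝ w (Matrix.toEuclideanCLM (𝕜 := ℝ) W u) = inner ℝ v u) :
    ∫ u : EuclideanSpace ℝ (Fin d), Complex.exp
      (-(2 * Real.pi) * ‖Matrix.toEuclideanCLM (𝕜 := ℝ) W u‖ ^ 2 +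
        2 * Real.pi * Complex.I * (inner ℝ v u : ℝ)) =
      ((|W.det|⁻¹ * (2 ^ ((d : ℝ) / 2))⁻¹ : ℝ) : ℂ) *
        Complex.exp (((-(Real.pi / 2) * ‖w‖ ^ 2 : ℝ) : ℂ)) := by
  simp only [← hvw]
  rw [integral_comp_toEuclideanCLM hW fun y => Complex.exp
    (-(2 * Real.pi) * ‖y‖ ^ 2 + 2 * Real.pi * Complex.I * (inner ℝ w y : ℝ)),
    GaussianFourier.integral_cexp_neg_mul_sq_norm_add_of_euclideanSpace
      (by simpa using Real.pi_pos)]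
  have hpi : (Real.pi : ℂ) ≠ 0 := by exact_mod_cast Real.pi_ne_zero
  have h1 : ((Real.pi : ℂ) / (2 * Real.pi)) ^ ((Fintype.card (Fin d) : ℂ) / 2) =
      (((2 ^ ((d : ℝ) / 2))⁻¹ : ℝ) : ℂ) := by
    have : (Real.pi : ℂ) / (2 * Real.pi) = ((2⁻¹ : ℝ) : ℂ) := by push_cast; field_simp
    rw [this, ← Real.inv_rpow (by norm_num), Complex.ofReal_cpow (by norm_num)]
    simp
  rw [h1, ← mul_assoc, ← Complex.ofReal_mul]
  congr 2
  push_cast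
  field_simp
  rw [Complex.I_sq]
  ring

/-- The shift `t = u + x/2` is symmetric between function and window. By the parallelogram law the
cross terms of `‖W (u ± x/2)‖²` cancel, while the `R`-terms leave only the linear phase `2⟨R x, u⟩`.
The shift also produces the factor `exp (-πi⟨x, ω⟩)`. -/
theorem stft_gaussian {W : Matrix (Fin d) (Fin d) ℝ} (hW : W.det ≠ 0)
    (R : EuclideanSpace ℝ (Fin d) →L[ℝ] EuclideanSpace ℝ (Fin d))
    (hR : ∀ u v, inner ℝ u (R v) = inner ℝ v (R u))
    (g : EuclideanSpace ℝ (Fin d) → ℂ)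
    (hg : ∀ t, g t = Complex.exp (Real.pi * Complex.I * ((inner ℝ t (R t) : ℝ) +
      Complex.I * ((‖Matrix.toEuclideanCLM (𝕜 := ℝ) W t‖ ^ 2 : ℝ) : ℂ))))
    (x ω w : EuclideanSpace ℝ (Fin d))
    (hw : ∀ u, inner ℝ w (Matrix.toEuclideanCLM (𝕜 := ℝ) W u) = inner ℝ (R x - ω) u) :
    stft g g x ω = ((|W.det|⁻¹ * (2 ^ ((d : ℝ) / 2))⁻¹ : ℝ) : ℂ) *
      (Complex.exp (-(Real.pi : ℂ) * Complex.I * ((inner ℝ x ω : ℝ) : ℂ)) *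
        Complex.exp ((-(Real.pi / 2) *
          (‖w‖ ^ 2 + ‖Matrix.toEuclideanCLM (𝕜 := ℝ) W x‖ ^ 2) : ℝ))) := by
  set L := Matrix.toEuclideanCLM (𝕜 := ℝ) W
  have hI : ∀ u, g (u + (2⁻¹ : ℝ) • x) * conj (g (u + (2⁻¹ : ℝ) • x - x)) *
      Complex.exp (-2 * (Real.pi : ℂ) * Complex.I * ((inner ℝ ω (u + (2⁻¹ : ℝ) • x) : ℝ) : ℂ)) =
      (Complex.exp (-(Real.pi : ℂ) * Complex.I * ((inner ℝ x ω : ℝ) : ℂ)) *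
        Complex.exp ((-(Real.pi / 2) * ‖L x‖ ^ 2 : ℝ))) *
      Complex.exp (-(2 * Real.pi) * ‖L u‖ ^ 2 +
        2 * Real.pi * Complex.I * (inner ℝ (R x - ω) u : ℝ)) := by
    intro u
    have e1 : u + (2⁻¹ : ℝ) • x - x = u - (2⁻¹ : ℝ) • x := by module
    rw [e1, hg, hg, ← Complex.exp_conj, ← Complex.exp_add, ← Complex.exp_add, ← Complex.exp_add,
      ← Complex.exp_add]
    congr 1
    have e2 : (‖L u‖ : ℂ) ^ 2 = ((inner ℝ (L u) (L u) : ℝ) : ℂ) := by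
      rw [real_inner_self_eq_norm_sq, Complex.ofReal_pow]
    rw [e2]
    simp only [map_add, map_sub, map_smul, ← real_inner_self_eq_norm_sq, inner_add_left,
      inner_add_right, inner_sub_left, inner_sub_right, real_inner_smul_left,
      real_inner_smul_right, real_inner_comm (L u) (L x), hR u x, real_inner_comm u (R x),
      real_inner_comm u ω, real_inner_comm x ω]
    push_cast
    simp only [map_mul, map_add, map_sub, Complex.conj_ofReal, Complex.conj_I, map_inv₀,
      map_ofNat]
    ring_nf
    simp only [Complex.I_sq]
    ring
  rw [stft, ← integral_add_right_eq_self _ ((2⁻¹ : ℝ) • x)]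
  simp only [hI]
  rw [integral_const_mul, integral_gaussian_toEuclideanCLM hW _ w hw, mul_left_comm, mul_assoc,
    ← Complex.exp_add]
  congr 4
  push_cast
  ring

end GaussianSTFT

/-! ### Hagedorn wavepackets as Schwartz functions -/

section Hagedorn

variable {d : ℕ} {Q P : Matrix (Fin d) (Fin d) ℂ}

/-- The raising operator of a frame on Schwartz functions. -/
noncomputable def raiseOp (Q P : Matrix (Fin d) (Fin d) ℂ) (j : Fin d) :
    𝓢(EuclideanSpace ℝ (Fin d), ℂ) →ₗ[ℂ] 𝓢(EuclideanSpace ℝ (Fin d), ℂ) :=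
  heisenbergOp (fun l => (√Real.pi : ℝ) * Complex.I * conj (P l j))
    (fun l => -((√Real.pi : ℝ) / (2 * Real.pi) * conj (Q l j)))

/-- The lowering operator of a frame on Schwartz functions. -/
noncomputable def lowerOp (Q P : Matrix (Fin d) (Fin d) ℂ) (j : Fin d) :
    𝓢(EuclideanSpace ℝ (Fin d), ℂ) →ₗ[ℂ] 𝓢(EuclideanSpace ℝ (Fin d), ℂ) :=
  heisenbergOp (fun l => -((√Real.pi : ℝ) * Complex.I * P l j))
    (fun l => (√Real.pi : ℝ) / (2 * Real.pi) * Q l j)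

theorem sqrt_pi_mul_sqrt_pi : ((√Real.pi : ℝ) : ℂ) * (√Real.pi : ℝ) = Real.pi := by
  rw [← Complex.ofReal_mul, Real.mul_self_sqrt Real.pi_pos.le]

theorem hagedornRaise_eq_raiseOp (Q P : Matrix (Fin d) (Fin d) ℂ) (j : Fin d)
    (f : 𝓢(EuclideanSpace ℝ (Fin d), ℂ)) : hagedornRaise Q P j f = raiseOp Q P j f := by
  ext t
  rw [hagedornRaise, raiseOp, heisenbergOp_apply, Finset.mul_sum]
  refine Finset.sum_congr rfl fun l _ => ?_
  linear_combination ((√Real.pi : ℝ) : ℂ) / (2 * Real.pi) * conj (Q l j) *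
    fderiv ℝ f t (EuclideanSpace.single l (1 : ℝ)) * Complex.I_sq

theorem raiseOp_comm (h : IsLagrangianFrame Q P) (i j : Fin d)
    (f : 𝓢(EuclideanSpace ℝ (Fin d), ℂ)) :
    raiseOp Q P i (raiseOp Q P j f) = raiseOp Q P j (raiseOp Q P i f) := by
  rw [raiseOp, raiseOp, heisenbergOp_comm]
  convert add_zero _
  convert zero_smul ℂ f
  have h1 := congrArg conj (h.sum_symm i j)
  simp only [map_sum, map_sub, map_mul, map_zero] at h1
  rw [← mul_zero (-((√Real.pi : ℝ) : ℂ) * (√Real.pi : ℝ) * Complex.I / (2 * Real.pi)), ← h1,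
    Finset.mul_sum]
  refine Finset.sum_congr rfl fun l _ => ?_
  ring

theorem lowerOp_raiseOp (h : IsLagrangianFrame Q P) (i j : Fin d)
    (f : 𝓢(EuclideanSpace ℝ (Fin d), ℂ)) :
    lowerOp Q P i (raiseOp Q P j f) =
      raiseOp Q P j (lowerOp Q P i f) + (if i = j then (1 : ℂ) else 0) • f := by
  rw [lowerOp, raiseOp, heisenbergOp_comm]
  congr 2
  have h1 := h.sum_normalized j i
  have hpi : (Real.pi : ℂ) ≠ 0 := by exact_mod_cast Real.pi_ne_zero
  have h2 : (if i = j then (1 : ℂ) else 0) =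
      -(Complex.I / 2) * (2 * Complex.I * (if j = i then 1 else 0)) := by
    simp only [eq_comm (a := j)]
    linear_combination (if i = j then (1 : ℂ) else 0) * Complex.I_sq
  rw [h2, ← h1, Finset.mul_sum]
  refine Finset.sum_congr rfl fun l _ => ?_
  field_simp
  rw [pow_two, sqrt_pi_mul_sqrt_pi]
  ring

/-- The coefficient map `(a, b) ↦ (conj a, -conj b)` of `stft_heisenbergOp` exchanges raising and
lowering operators. -/
theorem stft_raiseOp (g f : 𝓢(EuclideanSpace ℝ (Fin d), ℂ)) (x ω : EuclideanSpace ℝ (Fin d))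
    (j : Fin d) (z : ℂ) (hz : z = -Complex.I * (Pᵀ *ᵥ fun i => (x i : ℂ)) j +
      Complex.I * (Qᵀ *ᵥ fun i => (ω i : ℂ)) j) :
    stft g (raiseOp Q P j f) x ω =
      stft (lowerOp Q P j g) f x ω + (√Real.pi : ℝ) * conj z * stft g f x ω := by
  have hpi : (Real.pi : ℂ) ≠ 0 := by exact_mod_cast Real.pi_ne_zero
  have ha : (fun l => conj ((√Real.pi : ℝ) * Complex.I * conj (P l j))) =
      fun l => -((√Real.pi : ℝ) * Complex.I * P l j) := by funext l; simp
  have hb : (fun l => -conj (-((√Real.pi : ℝ) / (2 * Real.pi) * conj (Q l j)))) =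
      fun l => (√Real.pi : ℝ) / (2 * Real.pi) * Q l j := by funext l; simp [Complex.conj_ofNat]
  rw [raiseOp, stft_heisenbergOp, lowerOp, ha, hb]
  congr 2
  · rw [hz]
    simp only [Matrix.mulVec, dotProduct, Matrix.transpose_apply, map_add, map_mul, map_neg,
      Complex.conj_I, map_sum, Complex.conj_ofReal, Finset.mul_sum, ← Finset.sum_add_distrib]
    refine Finset.sum_congr rfl fun l _ => ?_
    field_simp

theorem stft_lowerOp (g f : 𝓢(EuclideanSpace ℝ (Fin d), ℂ)) (x ω : EuclideanSpace ℝ (Fin d))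
    (j : Fin d) (z : ℂ) (hz : z = -Complex.I * (Pᵀ *ᵥ fun i => (x i : ℂ)) j +
      Complex.I * (Qᵀ *ᵥ fun i => (ω i : ℂ)) j) :
    stft g (lowerOp Q P j f) x ω =
      stft (raiseOp Q P j g) f x ω + (√Real.pi : ℝ) * z * stft g f x ω := by
  have hpi : (Real.pi : ℂ) ≠ 0 := by exact_mod_cast Real.pi_ne_zero
  have ha : (fun l => conj (-((√Real.pi : ℝ) * Complex.I * P l j))) =
      fun l => (√Real.pi : ℝ) * Complex.I * conj (P l j) := by funext l; simp
  have hb : (fun l => -conj ((√Real.pi : ℝ) / (2 * Real.pi) * Q l j)) =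
      fun l => -((√Real.pi : ℝ) / (2 * Real.pi) * conj (Q l j)) := by
    funext l; simp [Complex.conj_ofNat]
  rw [lowerOp, stft_heisenbergOp, raiseOp, ha, hb]
  congr 2
  · rw [hz]
    simp only [Matrix.mulVec, dotProduct, Matrix.transpose_apply,
      Finset.mul_sum, ← Finset.sum_add_distrib]
    refine Finset.sum_congr rfl fun l _ => ?_
    field_simp

theorem stft_smul_smul (a b : ℂ) (g f : 𝓢(EuclideanSpace ℝ (Fin d), ℂ))
    (x ω : EuclideanSpace ℝ (Fin d)) :
    stft ⇑(a • g) ⇑(b • f) x ω = conj a * b * stft g f x ω := by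
  rw [stft, stft, ← integral_const_mul]
  refine integral_congr_ae (Filter.Eventually.of_forall fun t => ?_)
  simp only [_root_.smul_apply, smul_eq_mul, map_mul]
  ring

theorem stft_zero_right (g : 𝓢(EuclideanSpace ℝ (Fin d), ℂ)) (x ω : EuclideanSpace ℝ (Fin d)) :
    stft g (0 : 𝓢(EuclideanSpace ℝ (Fin d), ℂ)) x ω = 0 := by
  simpa using stft_smul_smul 1 0 g (0 : 𝓢(EuclideanSpace ℝ (Fin d), ℂ)) x ω

theorem stft_ladder (h : IsLagrangianFrame Q P) (v : 𝓢(EuclideanSpace ℝ (Fin d), ℂ))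
    (hv : ∀ j, lowerOp Q P j v = 0) (k n : Fin d → ℕ) (x ω : EuclideanSpace ℝ (Fin d))
    (z : Fin d → ℂ) (hz : ∀ j, z j = -Complex.I * (Pᵀ *ᵥ fun i => (x i : ℂ)) j +
      Complex.I * (Qᵀ *ᵥ fun i => (ω i : ℂ)) j) :
    stft ⇑(ladder (raiseOp Q P) v k) ⇑(ladder (raiseOp Q P) v n) x ω =
      stft v v x ω *
        ∏ j, hermiteTwo (n j) (k j) ((√Real.pi : ℝ) * conj (z j)) (-((√Real.pi : ℝ) * z j)) := by
  have hR := raiseOp_comm h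
  have hsmul (c : ℂ) (f g : 𝓢(EuclideanSpace ℝ (Fin d), ℂ)) :
      stft ⇑(c • g) f x ω = conj c * stft g f x ω := by
    simpa using stft_smul_smul c 1 g f x ω
  have := eq_mul_prod_hermiteTwo
    (fun k n => stft ⇑(ladder (raiseOp Q P) v k) ⇑(ladder (raiseOp Q P) v n) x ω)
    (fun j => (√Real.pi : ℝ) * conj (z j)) (fun j => -((√Real.pi : ℝ) * z j))
    (fun k n j => by
      rw [ladder_add_single hR, stft_raiseOp _ _ _ _ _ _ (hz j),
        lower_ladder hR (lowerOp_raiseOp h) hv, hsmul, Complex.conj_natCast])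
    (fun k j => by
      -- With `A_j v = 0` the left side vanishes, which yields the recursion in `k` at `n = 0`.
      have h1 := stft_lowerOp (ladder (raiseOp Q P) v k) v x ω j _ (hz j)
      rw [hv, stft_zero_right] at h1
      rw [ladder_add_single hR, ladder_zero]
      linear_combination -h1) k n
  simpa using this

theorem hasTemperateGrowth_quadratic (B : Matrix (Fin d) (Fin d) ℂ) :
    (fun t : EuclideanSpace ℝ (Fin d) => (Real.pi : ℂ) * Complex.I *
      ((fun i => (t i : ℂ)) ⬝ᵥ (B *ᵥ fun i => (t i : ℂ)))).HasTemperateGrowth := by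
  refine (Function.HasTemperateGrowth.const _).mul ?_
  refine Function.HasTemperateGrowth.sum fun i _ => (hasTemperateGrowth_coord i).mul ?_
  exact Function.HasTemperateGrowth.sum (s := Finset.univ)
      (f := fun j (t : EuclideanSpace ℝ (Fin d)) => B i j * (t j : ℂ)) fun j _ =>
    (Function.HasTemperateGrowth.const _).mul (hasTemperateGrowth_coord j)

theorem fderiv_quadratic {B : Matrix (Fin d) (Fin d) ℂ} (hB : Bᵀ = B)
    (t : EuclideanSpace ℝ (Fin d)) :
    ∃ L : EuclideanSpace ℝ (Fin d) →L[ℝ] ℂ,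
      HasFDerivAt (fun t : EuclideanSpace ℝ (Fin d) => (Real.pi : ℂ) * Complex.I *
        ((fun i => (t i : ℂ)) ⬝ᵥ (B *ᵥ fun i => (t i : ℂ)))) L t ∧
      ∀ l, L (EuclideanSpace.single l (1 : ℝ)) =
        2 * Real.pi * Complex.I * (B *ᵥ fun i => (t i : ℂ)) l := by
  have h1 := HasFDerivAt.const_mul (HasFDerivAt.fun_sum (u := Finset.univ) fun i _ =>
    (hasFDerivAt_coord i t).mul (HasFDerivAt.fun_sum (u := Finset.univ) fun j _ =>
      (hasFDerivAt_coord j t).const_mul (B i j))) ((Real.pi : ℂ) * Complex.I)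
  refine ⟨_, h1, fun l => ?_⟩
  have h2 (i : Fin d) : B i l = B l i := congrFun (congrFun hB l) i
  simp [Matrix.mulVec, dotProduct, Finset.sum_add_distrib, apply_ite Complex.ofReal, h2,
    mul_comm (t _ : ℂ)]
  ring

theorem exists_re_quadratic_le (h : IsLagrangianFrame Q P) :
    ∃ c : ℝ, 0 < c ∧ ∀ t : EuclideanSpace ℝ (Fin d), ((Real.pi : ℂ) * Complex.I *
      ((fun i => (t i : ℂ)) ⬝ᵥ ((P * Q⁻¹) *ᵥ fun i => (t i : ℂ)))).re ≤ -c * ‖t‖ ^ 2 := by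
  obtain ⟨W, hW, hU⟩ := h.exists_sqrt
  have hdet : IsUnit W.det := by
    have := abs_det_mul_norm_det hU
    refine isUnit_iff_ne_zero.2 fun h0 => ?_
    simp [h0] at this
  set C := ‖Matrix.toEuclideanCLM (𝕜 := ℝ) W⁻¹‖
  -- The real part is `-π‖W t‖²` and `‖t‖ ≤ C ‖W t‖`; the added `1` keeps the denominator positive
  -- also for `d = 0`, where `C = 0`.
  refine ⟨Real.pi / (1 + C ^ 2), by positivity, fun t => ?_⟩
  rw [quadratic_eq hW]
  have h1 : ‖t‖ ≤ C * ‖Matrix.toEuclideanCLM (𝕜 := ℝ) W t‖ := by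
    have h2 : Matrix.toEuclideanCLM (𝕜 := ℝ) W⁻¹ (Matrix.toEuclideanCLM (𝕜 := ℝ) W t) = t := by
      rw [← mul_apply_eq_comp, ← map_mul, Matrix.nonsing_inv_mul _ hdet, map_one]
      rfl
    conv_lhs => rw [← h2]
    exact ContinuousLinearMap.le_opNorm _ _
  have h3 : ‖t‖ ^ 2 ≤ (1 + C ^ 2) * ‖Matrix.toEuclideanCLM (𝕜 := ℝ) W t‖ ^ 2 := by
    have := pow_le_pow_left₀ (norm_nonneg t) h1 2
    rw [mul_pow] at this
    nlinarith [sq_nonneg ‖Matrix.toEuclideanCLM (𝕜 := ℝ) W t‖]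
  have h4 : Real.pi / (1 + C ^ 2) * ‖t‖ ^ 2 ≤
      Real.pi * ‖Matrix.toEuclideanCLM (𝕜 := ℝ) W t‖ ^ 2 := by
    rw [div_mul_eq_mul_div, div_le_iff₀ (by positivity)]
    nlinarith [Real.pi_pos]
  rw [mul_assoc, Complex.re_ofReal_mul]
  simp [-Complex.ofReal_pow, mul_add, ← mul_assoc]
  linarith

/-- The unnormalized Gaussian `exp(πi t·PQ⁻¹t)` of a frame as a Schwartz function. -/
noncomputable def frameGaussian (h : IsLagrangianFrame Q P) : 𝓢(EuclideanSpace ℝ (Fin d), ℂ) :=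
  expSchwartz _ (hasTemperateGrowth_quadratic (P * Q⁻¹)) (exists_re_quadratic_le h)

theorem frameGaussian_apply (h : IsLagrangianFrame Q P) (t : EuclideanSpace ℝ (Fin d)) :
    frameGaussian h t = Complex.exp ((Real.pi : ℂ) * Complex.I *
      ((fun i => (t i : ℂ)) ⬝ᵥ ((P * Q⁻¹) *ᵥ fun i => (t i : ℂ)))) := rfl

/-- The logarithmic gradient of the Gaussian is `2πi P Q⁻¹ t`, so the result is proportional to
`((Qᵀ P Q⁻¹ - Pᵀ) t)_j`, and the matrix is zero. -/
theorem lowerOp_frameGaussian (h : IsLagrangianFrame Q P) (j : Fin d) :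
    lowerOp Q P j (frameGaussian h) = 0 := by
  ext t
  obtain ⟨L, hL, hL'⟩ := fderiv_quadratic h.transpose_mul_inv t
  have h1 : HasFDerivAt (frameGaussian h) _ t := hL.cexp
  have h2 : ∑ l, Qᵀ j l * ((P * Q⁻¹) *ᵥ fun i => (t i : ℂ)) l = ∑ l, Pᵀ j l * (t l : ℂ) := by
    have := congrFun (congrArg (fun M => M *ᵥ fun i => (t i : ℂ)) h.transpose_mul) j
    rwa [← Matrix.mulVec_mulVec] at this
  have hpi : (Real.pi : ℂ) ≠ 0 := by exact_mod_cast Real.pi_ne_zero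
  rw [lowerOp, heisenbergOp_apply, h1.fderiv]
  simp only [_root_.smul_apply, hL', smul_eq_mul, ← frameGaussian_apply h]
  calc _ = (√Real.pi : ℝ) * Complex.I * frameGaussian h t *
        (∑ l, Qᵀ j l * ((P * Q⁻¹) *ᵥ fun i => (t i : ℂ)) l - ∑ l, Pᵀ j l * (t l : ℂ)) := by
        rw [← Finset.sum_sub_distrib, Finset.mul_sum]
        refine Finset.sum_congr rfl fun l _ => ?_
        simp only [Matrix.transpose_apply]
        field_simp
        ring
    _ = _ := by rw [h2]; simp

theorem hagedorn_eq_ladder (h : IsLagrangianFrame Q P) (s : ℂ) (k : Fin d → ℕ) :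
    hagedorn Q P s k = ⇑(((1 / √(∏ j, ((k j)! : ℝ)) : ℝ) : ℂ) •
      ladder (raiseOp Q P) (((((2 : ℝ) ^ ((d : ℝ) / 4) : ℝ) : ℂ) * s⁻¹) • frameGaussian h) k) := by
  have h1 : hagedornGaussian Q P s =
      ⇑(((((2 : ℝ) ^ ((d : ℝ) / 4) : ℝ) : ℂ) * s⁻¹) • frameGaussian h) := rfl
  have h2 (l : List (Fin d)) (v : 𝓢(EuclideanSpace ℝ (Fin d), ℂ)) :
      l.foldr (fun j f => (hagedornRaise Q P j)^[k j] f) (v : EuclideanSpace ℝ (Fin d) → ℂ) =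
        ⇑(ladderList (fun j => raiseOp Q P j) v k l) := by
    induction l with
    | nil => rfl
    | cons j l ih =>
      rw [List.foldr_cons, ih]
      exact ((Function.Semiconj.iterate_right
        (f := fun f : 𝓢(EuclideanSpace ℝ (Fin d), ℂ) => (f : EuclideanSpace ℝ (Fin d) → ℂ))
        (fun f => (hagedornRaise_eq_raiseOp Q P j f).symm) (k j)).eq _).symm
  ext t
  rw [hagedorn, h1]
  exact congrArg (_ * ·) (congrFun (h2 _ _) t)

theorem memLp_hagedorn (h : IsLagrangianFrame Q P) (s : ℂ) (k : Fin d → ℕ) :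
    MemLp (hagedorn Q P s k) 2 volume := by
  rw [hagedorn_eq_ladder h]
  exact SchwartzMap.memLp _ 2 volume

end Hagedorn

/-! ### The short-time Fourier transform of Hagedorn wavepackets -/

section Main

variable {d : ℕ} {Q P : Matrix (Fin d) (Fin d) ℂ}

/-- With `a = w + i W x` one has `Wᵀ a = P Q⁻¹ x - ω`, hence `ζ = -i (W Q)ᵀ a`, and `(W Q)ᵀ` is
unitary. -/
theorem norm_sq_phase (h : IsLagrangianFrame Q P) {W : Matrix (Fin d) (Fin d) ℝ}
    (hW : (P * Q⁻¹).map Complex.im = Wᵀ * W)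
    (hU : W.map Complex.ofRealHom * Q ∈ Matrix.unitaryGroup (Fin d) ℂ)
    (x ω w : EuclideanSpace ℝ (Fin d)) (ζ : EuclideanSpace ℂ (Fin d))
    (hζ : ∀ j, ζ j = -Complex.I * (Pᵀ *ᵥ fun i => (x i : ℂ)) j +
      Complex.I * (Qᵀ *ᵥ fun i => (ω i : ℂ)) j)
    (hw : Wᵀ *ᵥ w = (P * Q⁻¹).map Complex.re *ᵥ x - ω) :
    ‖ζ‖ ^ 2 = ‖w‖ ^ 2 + ‖Matrix.toEuclideanCLM (𝕜 := ℝ) W x‖ ^ 2 := by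
  set O := W.map Complex.ofRealHom * Q
  set a : Fin d → ℂ := fun i => (w i : ℂ) + Complex.I * ((W *ᵥ x) i : ℂ)
  have h1 : (W.map Complex.ofRealHom)ᵀ *ᵥ a =
      (P * Q⁻¹) *ᵥ (fun i => (x i : ℂ)) - fun i => (ω i : ℂ) := by
    ext i
    have e1 := congrFun hw i
    have e2 := congrFun (congrArg (fun M => M *ᵥ (x : Fin d → ℝ)) hW) i
    simp only [← Matrix.mulVec_mulVec] at e2
    have e3 (u : Fin d → ℝ) :
        ((W.map Complex.ofRealHom)ᵀ *ᵥ fun i => (w i : ℂ) + Complex.I * (u i : ℂ)) i =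
        ((Wᵀ *ᵥ w) i : ℝ) + Complex.I * ((Wᵀ *ᵥ u) i : ℝ) := by
      simp only [Matrix.mulVec, dotProduct, Complex.ofReal_sum, Finset.mul_sum,
        ← Finset.sum_add_distrib, Matrix.transpose_apply, Matrix.map_apply, Complex.ofReal_mul,
        Complex.ofRealHom_eq_coe]
      exact Finset.sum_congr rfl fun l _ => by ring
    rw [e3, e1, ← e2]
    apply Complex.ext <;> simp [Matrix.mulVec, dotProduct]
  have h2 : (ζ : Fin d → ℂ) = -Complex.I • (Oᵀ *ᵥ a) := by
    rw [Matrix.transpose_mul, ← Matrix.mulVec_mulVec, h1, Matrix.mulVec_sub, Matrix.mulVec_mulVec,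
      h.transpose_mul]
    ext j
    rw [hζ]
    simp
    ring
  have h3 : (Oᵀ)ᴴ * Oᵀ = 1 := by
    rw [Matrix.mem_unitaryGroup_iff, Matrix.star_eq_conjTranspose] at hU
    have := congrArg Matrix.transpose hU
    rwa [Matrix.transpose_mul, Matrix.transpose_one] at this
  have h4 : star (ζ : Fin d → ℂ) ⬝ᵥ (ζ : Fin d → ℂ) = star a ⬝ᵥ a := by
    rw [h2, star_smul, smul_dotProduct, dotProduct_smul, Matrix.star_mulVec,
      ← Matrix.dotProduct_mulVec, Matrix.mulVec_mulVec, h3, Matrix.one_mulVec, smul_smul]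
    simp
  have h5 : ∑ j, ‖ζ j‖ ^ 2 = ∑ j, ‖a j‖ ^ 2 := by
    have e (b : Fin d → ℂ) : star b ⬝ᵥ b = ((∑ j, ‖b j‖ ^ 2 : ℝ) : ℂ) := by
      rw [dotProduct]
      push_cast
      exact Finset.sum_congr rfl fun j _ => Complex.conj_mul' _
    rw [e, e] at h4
    exact_mod_cast h4
  rw [EuclideanSpace.norm_sq_eq, EuclideanSpace.norm_sq_eq, EuclideanSpace.norm_sq_eq, h5,
    ← Finset.sum_add_distrib]
  refine Finset.sum_congr rfl fun j _ => ?_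
  rw [Complex.sq_norm, Complex.normSq_apply, Matrix.ofLp_toEuclideanCLM]
  simp [a]
  ring

theorem stft_hagedornGaussian (h : IsLagrangianFrame Q P) (s : ℂ) (hs : s ^ 2 = Q.det)
    (x ω : EuclideanSpace ℝ (Fin d)) (ζ : EuclideanSpace ℂ (Fin d))
    (hζ : ∀ j, ζ j = -Complex.I * (Pᵀ *ᵥ fun i => (x i : ℂ)) j +
      Complex.I * (Qᵀ *ᵥ fun i => (ω i : ℂ)) j) :
    stft ⇑(((((2 : ℝ) ^ ((d : ℝ) / 4) : ℝ) : ℂ) * s⁻¹) • frameGaussian h)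
      ⇑(((((2 : ℝ) ^ ((d : ℝ) / 4) : ℝ) : ℂ) * s⁻¹) • frameGaussian h) x ω =
      Complex.exp (-(Real.pi : ℂ) * Complex.I * ((inner ℝ x ω : ℝ) : ℂ)) *
        Complex.exp (((-(Real.pi / 2) * ‖ζ‖ ^ 2 : ℝ) : ℂ)) := by
  obtain ⟨W, hW, hU⟩ := h.exists_sqrt
  have hdet := abs_det_mul_norm_det hU
  have hdet0 : W.det ≠ 0 := by
    intro h0
    simp [h0] at hdet
  have hQ0 : ‖Q.det‖ ≠ 0 := norm_ne_zero_iff.2 h.isUnit_det.ne_zero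
  set B := (P * Q⁻¹).map Complex.re
  set R := Matrix.toEuclideanCLM (𝕜 := ℝ) B
  have hB : Bᵀ = B := by
    rw [← Matrix.transpose_map, h.transpose_mul_inv]
  have hR (u v : EuclideanSpace ℝ (Fin d)) : inner ℝ u (R v) = inner ℝ v (R u) := by
    rw [Matrix.inner_toEuclideanCLM, Matrix.inner_toEuclideanCLM, Matrix.dotProduct_mulVec,
      dotProduct_comm, ← Matrix.mulVec_transpose, hB]
  set w : EuclideanSpace ℝ (Fin d) := Matrix.toEuclideanCLM (𝕜 := ℝ) (W⁻¹)ᵀ (R x - ω)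
  have hw : Wᵀ *ᵥ w = B *ᵥ x - ω := by
    rw [Matrix.ofLp_toEuclideanCLM, Matrix.mulVec_mulVec, ← Matrix.transpose_mul,
      Matrix.nonsing_inv_mul _ (isUnit_iff_ne_zero.2 hdet0), Matrix.transpose_one,
      Matrix.one_mulVec]
    rfl
  have hw' (u : EuclideanSpace ℝ (Fin d)) :
      inner ℝ w (Matrix.toEuclideanCLM (𝕜 := ℝ) W u) = inner ℝ (R x - ω) u := by
    rw [Matrix.inner_toEuclideanCLM, Matrix.dotProduct_mulVec, ← Matrix.mulVec_transpose, hw]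
    simp [EuclideanSpace.inner_eq_star_dotProduct, dotProduct_comm, R]
  rw [stft_smul_smul, stft_gaussian hdet0 R hR _
    (fun t => by rw [frameGaussian_apply, quadratic_eq hW]) x ω w hw',
    ← norm_sq_phase h hW hU x ω w ζ hζ hw, ← mul_assoc, Complex.conj_mul', ← Complex.ofReal_pow,
    ← Complex.ofReal_mul]
  -- The remaining constant is `|2^(d/4) s⁻¹|² |det W|⁻¹ 2^(-d/2)`. Only `|s|² = |det Q|` enters, so
  -- the choice of square root is immaterial.
  convert one_mul _
  have h1 : |W.det|⁻¹ = ‖Q.det‖ := inv_eq_of_mul_eq_one_right hdet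
  have h2 : ((2 : ℝ) ^ ((d : ℝ) / 4)) ^ 2 = 2 ^ ((d : ℝ) / 2) := by
    rw [← Real.rpow_natCast, ← Real.rpow_mul (by norm_num)]
    congr 1
    push_cast
    ring
  rw [h1, norm_mul, mul_pow, Complex.norm_real, Real.norm_eq_abs, sq_abs, h2, norm_inv, inv_pow,
    ← norm_pow, hs]
  have h3 : (2 : ℝ) ^ ((d : ℝ) / 2) ≠ 0 := by positivity
  rw [Complex.ofReal_eq_one]
  field_simp

/-- The short-time Fourier transform of Hagedorn wavepackets. -/
theorem stft_hagedorn (h : IsLagrangianFrame Q P) (s : ℂ) (hs : s ^ 2 = Q.det)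
    (k n : Fin d → ℕ) (x ω : EuclideanSpace ℝ (Fin d)) (ζ : EuclideanSpace ℂ (Fin d))
    (hζ : ∀ j, ζ j = -Complex.I * (Pᵀ *ᵥ fun i => (x i : ℂ)) j +
      Complex.I * (Qᵀ *ᵥ fun i => (ω i : ℂ)) j) :
    stft (hagedorn Q P s k) (hagedorn Q P s n) x ω =
      Complex.exp (-(Real.pi : ℂ) * Complex.I * ((inner ℝ x ω : ℝ) : ℂ)) *
        Complex.exp (((-(Real.pi / 2) * ‖ζ‖ ^ 2 : ℝ) : ℂ)) *
        ∏ j, conj (complexHermite (n j) (k j) (ζ j)) := by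
  have hsqrt (k : Fin d → ℕ) : √(∏ j, ((k j)! : ℝ)) = ∏ j, √((k j)! : ℝ) :=
    Real.sqrt_prod _ fun _ _ => Nat.cast_nonneg _
  rw [hagedorn_eq_ladder h, hagedorn_eq_ladder h, stft_smul_smul,
    stft_ladder h _ (fun j => by rw [map_smul, lowerOp_frameGaussian, smul_zero]) k n x ω ζ hζ,
    stft_hagedornGaussian h s hs x ω ζ hζ, mul_left_comm]
  simp only [conj_complexHermite, Finset.prod_div_distrib, Finset.prod_mul_distrib,
    hsqrt, Complex.conj_ofReal]
  push_cast
  ring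

end Main

/-! ### Hermite functions as Hagedorn wavepackets of the standard frame -/

section Standard

theorem isLagrangianFrame_standard (d : ℕ) :
    IsLagrangianFrame (1 : Matrix (Fin d) (Fin d) ℂ) (Complex.I • 1) where
  symm := by simp
  normalized := by
    simp [Matrix.conjTranspose_smul, sub_eq_add_neg, ← add_smul, two_mul]

/-- Differentiating the factor `exp (π t²)` produces `2πt`, which cancels the multiplication by `t`;
what is left is the next derivative with factor `-1/(2√π)`. -/
theorem hermiteFn_succ (n : ℕ) (t : ℝ) :
    DifferentiableAt ℝ (hermiteFn n) t ∧
    √(((n + 1)! : ℕ) : ℝ) * hermiteFn (n + 1) t =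
      √Real.pi * (t * (√(n ! : ℝ) * hermiteFn n t) -
        √(n ! : ℝ) * deriv (hermiteFn n) t / (2 * Real.pi)) := by
  set g : ℝ → ℝ := fun s => Real.exp (-2 * Real.pi * s ^ 2)
  have hg : ContDiff ℝ ⊤ g := by fun_prop
  have h1 : HasDerivAt (iteratedDeriv n g) (iteratedDeriv (n + 1) g t) t := by
    rw [iteratedDeriv_succ]
    exact ((hg.differentiable_iteratedDeriv n (by simp)) t).hasDerivAt
  have h2 : HasDerivAt (fun t : ℝ => Real.exp (Real.pi * t ^ 2))
      (Real.exp (Real.pi * t ^ 2) * (Real.pi * (2 * t))) t := by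
    have := ((hasDerivAt_pow 2 t).const_mul Real.pi).exp
    simpa using this
  have h3 : HasDerivAt (hermiteFn n) _ t :=
    ((h2.const_mul ((2 : ℝ) ^ ((1 : ℝ) / 4) / √(n ! : ℝ) * (-1 / (2 * √Real.pi)) ^ n)).mul
      h1)
  refine ⟨h3.differentiableAt, ?_⟩
  have hn : √(n ! : ℝ) ≠ 0 := by
    rw [Real.sqrt_ne_zero']; exact_mod_cast n.factorial_pos
  have hn1 : √((n + 1)! : ℝ) ≠ 0 := by
    rw [Real.sqrt_ne_zero']; exact_mod_cast (n + 1).factorial_pos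
  have hpi : √Real.pi ≠ 0 := by positivity
  rw [h3.deriv, hermiteFn, hermiteFn, pow_succ]
  change _ * (_ / _ * _ * _ * iteratedDeriv (n + 1) g t) =
    _ * (_ * (_ * (_ * iteratedDeriv n g t)) - _)
  generalize iteratedDeriv (n + 1) g t = D1
  generalize iteratedDeriv n g t = D0
  generalize Real.exp (Real.pi * t ^ 2) = E
  generalize (-1 / (2 * √Real.pi)) ^ n = C
  field_simp
  rw [Real.sq_sqrt Real.pi_pos.le]
  ring

theorem raiseOp_standard_apply {d : ℕ} (j : Fin d) (f : 𝓢(EuclideanSpace ℝ (Fin d), ℂ))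
    (t : EuclideanSpace ℝ (Fin d)) :
    raiseOp (1 : Matrix (Fin d) (Fin d) ℂ) (Complex.I • 1) j f t =
      (√Real.pi : ℝ) * (t j * f t -
        fderiv ℝ f t (EuclideanSpace.single j (1 : ℝ)) / (2 * Real.pi)) := by
  rw [raiseOp, heisenbergOp_apply, Finset.sum_eq_single j]
  · simp
    linear_combination -((√Real.pi : ℝ) : ℂ) * (t j * f t) * Complex.I_sq
  · intro l _ hl
    simp [hl]
  · simp

theorem ladder_standard_apply {d : ℕ} (k : Fin d → ℕ) (t : EuclideanSpace ℝ (Fin d)) :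
    ladder (raiseOp (1 : Matrix (Fin d) (Fin d) ℂ) (Complex.I • 1))
      (((((2 : ℝ) ^ ((d : ℝ) / 4) : ℝ) : ℂ) * 1⁻¹) •
        frameGaussian (isLagrangianFrame_standard d)) k t =
      ((∏ j, √((k j)! : ℝ) * hermiteFn (k j) (t j) : ℝ) : ℂ) := by
  induction k using Pi.induction_add_single generalizing t with
  | h0 =>
    rw [ladder_zero]
    have h1 (j : Fin d) : √(((0 : Fin d → ℕ) j)! : ℝ) * hermiteFn ((0 : Fin d → ℕ) j) (t j) =
        2 ^ ((1 : ℝ) / 4) * Real.exp (-(Real.pi * t j ^ 2)) := by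
      simp only [Pi.zero_apply, hermiteFn, iteratedDeriv_zero, Nat.factorial_zero, pow_zero,
        Nat.cast_one, Real.sqrt_one, one_mul, div_one, mul_one]
      rw [mul_assoc, ← Real.exp_add]
      ring_nf
    simp only [h1]
    rw [Finset.prod_mul_distrib, Finset.prod_const, ← Real.exp_sum, Finset.card_univ,
      Fintype.card_fin, ← Real.rpow_natCast, ← Real.rpow_mul (by norm_num), Complex.ofReal_mul,
      Complex.ofReal_exp, inv_one, mul_one, one_div_mul_eq_div]
    refine congrArg (_ * Complex.exp ·) ?_
    simp [dotProduct, Finset.mul_sum, Matrix.smul_mulVec, -Finset.sum_neg_distrib]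
    refine Finset.sum_congr rfl fun j _ => ?_
    linear_combination (Real.pi : ℂ) * t j ^ 2 * Complex.I_sq
  | h1 k j ih =>
    rw [ladder_add_single (raiseOp_comm (isLagrangianFrame_standard d)), raiseOp_standard_apply]
    set f := ladder (raiseOp (1 : Matrix (Fin d) (Fin d) ℂ) (Complex.I • 1))
      (((((2 : ℝ) ^ ((d : ℝ) / 4) : ℝ) : ℂ) * 1⁻¹) •
        frameGaussian (isLagrangianFrame_standard d)) k
    set C := ∏ i ∈ Finset.univ.erase j, √((k i)! : ℝ) * hermiteFn (k i) (t i)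
    -- On the line through `t` in direction `e_j` only the `j`-th factor varies, so the partial
    -- derivative is a one-dimensional one.
    have h1 (r : ℝ) : f (t + r • EuclideanSpace.single j (1 : ℝ)) =
        ((√((k j)! : ℝ) * hermiteFn (k j) (t j + r) * C : ℝ) : ℂ) := by
      rw [ih, ← Finset.mul_prod_erase _ _ (Finset.mem_univ j)]
      congr 2
      · simp
      · exact Finset.prod_congr rfl fun i hi => by simp [Finset.ne_of_mem_erase hi]
    obtain ⟨hd, hs⟩ := hermiteFn_succ (k j) (t j)
    have h2 : HasDerivAt (fun r : ℝ => f (t + r • EuclideanSpace.single j (1 : ℝ)))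
        ((√((k j)! : ℝ) * deriv (hermiteFn (k j)) (t j) * C : ℝ) : ℂ) 0 := by
      simp only [h1]
      refine HasDerivAt.ofReal_comp (HasDerivAt.mul_const (HasDerivAt.const_mul _ ?_) _)
      have h3 : HasDerivAt (hermiteFn (k j)) (deriv (hermiteFn (k j)) (t j)) (t j + 0) := by
        rw [add_zero]; exact hd.hasDerivAt
      exact h3.comp_const_add (t j) 0
    have h4 : fderiv ℝ f t (EuclideanSpace.single j (1 : ℝ)) =
        ((√((k j)! : ℝ) * deriv (hermiteFn (k j)) (t j) * C : ℝ) : ℂ) :=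
      ((f.hasFDerivAt t).hasLineDerivAt (EuclideanSpace.single j (1 : ℝ))).unique h2
    have h5 : ∏ i ∈ Finset.univ.erase j, √(((k + Pi.single j 1 : Fin d → ℕ) i)! : ℝ) *
        hermiteFn ((k + Pi.single j 1 : Fin d → ℕ) i) (t i) = C :=
      Finset.prod_congr rfl fun i hi => by simp [Finset.ne_of_mem_erase hi]
    have h6 : f t = ((√((k j)! : ℝ) * hermiteFn (k j) (t j) * C : ℝ) : ℂ) := by
      simpa using h1 0
    rw [← Finset.mul_prod_erase _ _ (Finset.mem_univ j), h5, h4, h6, Pi.add_apply,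
      Pi.single_eq_same, hs]
    push_cast
    ring

theorem hagedorn_standard {d : ℕ} (k : Fin d → ℕ) :
    hagedorn (1 : Matrix (Fin d) (Fin d) ℂ) (Complex.I • 1) 1 k = productHermite k := by
  ext t
  rw [hagedorn_eq_ladder (isLagrangianFrame_standard d), _root_.smul_apply, ladder_standard_apply,
    productHermite, smul_eq_mul, ← Complex.ofReal_mul, Finset.prod_mul_distrib,
    Real.sqrt_prod _ fun _ _ => Nat.cast_nonneg _, ← mul_assoc, one_div_mul_cancel, one_mul]
  refine Finset.prod_ne_zero_iff.2 fun j _ => ?_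
  rw [Real.sqrt_ne_zero']
  exact_mod_cast (k j).factorial_pos

/-- Up to a unimodular phase the transform depends on the frame and the point only through `ζ`. For
the standard frame `ζ` at `z` is `-i (i z.1) + i z.2`, that is, `phaseToComplex z`. -/
theorem norm_stft_hagedorn {d : ℕ} {Q P : Matrix (Fin d) (Fin d) ℂ} (h : IsLagrangianFrame Q P)
    (s : ℂ) (hs : s ^ 2 = Q.det) (k n : Fin d → ℕ) (x ω : EuclideanSpace ℝ (Fin d))
    (z : EuclideanSpace ℝ (Fin d) × EuclideanSpace ℝ (Fin d))
    (hz : ∀ j, phaseToComplex z j = -Complex.I * (Pᵀ *ᵥ fun i => (x i : ℂ)) j +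
      Complex.I * (Qᵀ *ᵥ fun i => (ω i : ℂ)) j) :
    ‖stft (hagedorn Q P s k) (hagedorn Q P s n) x ω‖ =
      ‖stft (productHermite k) (productHermite n) z.1 z.2‖ := by
  have hphase (r : ℝ) : ‖Complex.exp (-(Real.pi : ℂ) * Complex.I * (r : ℂ))‖ = 1 := by
    rw [Complex.norm_exp]; simp
  rw [← hagedorn_standard, ← hagedorn_standard, stft_hagedorn h s hs k n x ω _ hz,
    stft_hagedorn (isLagrangianFrame_standard d) 1 (by simp) k n z.1 z.2 (phaseToComplex z)
      (fun j => ?_)]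
  · simp only [norm_mul, hphase]
  · simp [phaseToComplex, Matrix.transpose_smul, Matrix.smul_mulVec]
    linear_combination (z.1 j : ℂ) * Complex.I_sq

end Standard

end HagedornSTFT

theorem mainTheorem11 {d : ℕ} (Q P : Matrix (Fin d) (Fin d) ℂ) (hQP : IsLagrangianFrame Q P)
    (s : ℂ) (hs : s ^ 2 = Q.det) :
    frameMatrix Q P ∈ Matrix.symplecticGroup (Fin d) ℝ ∧
    (∀ k : Fin d → ℕ, MemLp (hagedorn Q P s k) 2 volume) ∧
    ∀ (k n : Fin d → ℕ) (x ω : EuclideanSpace ℝ (Fin d))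
      (z' : EuclideanSpace ℝ (Fin d) × EuclideanSpace ℝ (Fin d)) (ζ : EuclideanSpace ℂ (Fin d)),
      z' = phaseMulVec (frameMatrix Q P)⁻¹ (x, ω) →
      ζ = phaseToComplex z' →
      (∀ j, ζ j = -Complex.I * (Pᵀ *ᵥ fun i => (x i : ℂ)) j +
        Complex.I * (Qᵀ *ᵥ fun i => (ω i : ℂ)) j) ∧
      stft (hagedorn Q P s k) (hagedorn Q P s n) x ω =
        Complex.exp (-(Real.pi : ℂ) * Complex.I * ((inner ℝ x ω : ℝ) : ℂ)) *
          Complex.exp (((-(Real.pi / 2) * ‖ζ‖ ^ 2 : ℝ) : ℂ)) *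
          ∏ j, conj (complexHermite (n j) (k j) (ζ j)) ∧
      ‖stft (hagedorn Q P s k) (hagedorn Q P s n) x ω‖ =
        ‖stft (productHermite k) (productHermite n) z'.1 z'.2‖ := by
  refine ⟨hQP.frameMatrix_mem_symplecticGroup, memLp_hagedorn hQP s, ?_⟩
  rintro k n x ω z' ζ rfl rfl
  have hζ := phaseToComplex_frameMatrix_inv hQP x ω
  exact ⟨hζ, stft_hagedorn hQP s hs k n x ω _ hζ, norm_stft_hagedorn hQP s hs k n x ω _ hζ⟩
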